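/- **Setting.** All manifolds and maps are smooth, and $T=(S^1)^2$, $S^1=\{\lambda\in\mathbb C: |\lambda|=1\}$. A moment map for an action of $T$ on a symplectic manifold $(N,\omega)$ is a map $\Phi=(\Phi_1,\Phi_2)\colon N\to\mathbb R^2$ with $d\Phi_j=-\iota(\xi_j)\omega$, where $\xi_j$ is the velocity field of $t\mapsto e^{it}$ acting through the $j$-th circle. A *corner manifold* is a connected symplectic $4$-manifold with an effective action of $T$ and a proper moment map $\Phi$ whose image lies in $(\mathbb R_{\ge0})^2$ and contains all points of $(\mathbb R_{\ge 0})^2$ with sufficiently large coordinate sum. Let $n\ge2$ and let $$\Delta=\bigcap_{i=1}^n\{w\in\mathbb R^2:\langle w,v_i\rangle\ge a_i\},\qquad v_i=(\alpha_i,\beta_i)\in\mathbb Z^2,\ a_i\in\mathbb R,$$ where $v_1=(1,0)$, $v_n=(0,1)$, $a_1=a_n=0$, the $v_i$ are ordered counter-clockwise (so $\det(v_i,v_j)>0$ for $i<j$), each set $\{w\in\Delta:\langle w,v_i\rangle=a_i\}$ is a non-trivial edge (it has more than one point), and $v_i,v_{i+1}$ form a basis of $\mathbb Z^2$ for $1\le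 i<n$. Let $$M_\Delta=\Big\{x\in\mathbb C^n:\tfrac12(\alpha_i|x_1|^2-|x_i|^2+\beta_i|x_n|^2)=a_i\ \text{ for } 1<i<n\Big\}\Big/K,$$ $$K=\Big\{k\in(S^1)^n:\textstyle\prod_i k_i^{\alpha_i}=\prod_i k_i^{\beta_i}=1\Big\},$$ with the symplectic form induced by $\frac i2\sum_j dx_j\wedge d\bar x_j$, the action $(\lambda_1,\lambda_2)\cdot[x]=[\lambda_1x_1,x_2,\dots,x_{n-1},\lambda_2x_n]$ and the moment map $[x]\mapsto\frac12(|x_1|^2,|x_n|^2)$. Let $N$ be a corner manifold with moment image $\Delta$, identified with $M_\Delta$ by a $T$-equivariant symplectomorphism that intertwines the moment maps. For $1<i<n$ let $S_i=\{p\in N:\langle\Phi(p),v_i\rangle=a_i\}$, let $D=\bigcup_{1<i<n}S_i$ be the chain of isotropy spheres, and let $$\psi\colon N\smallsetminus D\to\mathbb C^2,\qquad \psi([x])=\Big(x_1\prod_{1<j<n}\big(x_j/|x_j|\big)^{\alpha_j},\ x_n\prod_{1<j<n}\big(x_j/|x_j|\big)^{\beta_j}\Big)$$ be the symplectic blowup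 map. Let $N'$ be a mirror of $N$: a corner manifold with moment map $\Phi'$ and moment image $\Delta'$, the reflection of $\Delta$ across the diagonal, which is given by $v'_i=(\beta_{n+1-i},\alpha_{n+1-i})$ and $a'_i=a_{n+1-i}$, identified in the same way with $M_{\Delta'}$; let $S'_i$, $D'$, $\psi'$ be the corresponding objects. For $\varepsilon>0$ let $U_\varepsilon$ be the preimage under $\Phi$ of $\{w: w_1\ge0,\ w_2\ge0,\ w_1+w_2<\varepsilon\}$; it is called a triangular neighborhood if it contains $D$. **Lemma.** Let $\beta>0$ be such that $U_\beta$ is a triangular neighborhood of $D$. There is a diffeomorphism $H\colon N\to N'$, preserving the orientations defined by the symplectic forms, such that - $(\psi'\circ H\circ\psi^{-1})(z)=z$ for all $z\in\psi(N\smallsetminus U_\beta)$; that is, for every $p\in N\smallsetminus U_\beta$ one has $H(p)\notin D'$ and $\psi'(H(p))=\psi(p)$; - $H$ intertwines the moment maps for the diagonal circle actions: $(\Phi'_1+\Phi'_2)\circ H=\Phi_1+\Phi_2$; - $H$ is equivariant for the anti-diagonal circle actions: $H((\lambda,\lambda^{-1})\cdot p)=(\lambda,\lambda^{-1})\cdot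 H(p)$ for all $\lambda\in S^1$, $p\in N$; - $H(S_i)=S'_{n+1-i}$ for all $1<i<n$. -/

import Mathlib

open scoped Manifold ContDiff Topology

noncomputable section

/-! ### Symplectic `4`-manifolds with Hamiltonian torus action

Smooth `4`-manifolds are modelled on `ℂ × ℂ`, regarded as a real vector space. A differential
`2`-form on `N` is a field of bilinear forms on the tangent spaces. -/

/-- A field of bilinear forms on the tangent spaces of `N`. -/
abbrev BilinField (N : Type*) [TopologicalSpace N] [ChartedSpace (ℂ × ℂ) N] :=
  ∀ p : N, TangentSpace 𝓘(ℝ, ℂ × ℂ) p →L[ℝ] TangentSpace 𝓘(ℝ, ℂ × ℂ) p →L[ℝ] ℝ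

section Symplectic

variable {N : Type*} [TopologicalSpace N] [ChartedSpace (ℂ × ℂ) N]

/-- The local representation of `Ω` in the preferred chart at `p`: the pull-back of `Ω` under the
inverse of that chart. -/
def BilinField.inChart (Ω : BilinField N) (p : N) (y : ℂ × ℂ) : (ℂ × ℂ) →L[ℝ] (ℂ × ℂ) →L[ℝ] ℝ :=
  let e := (extChartAt 𝓘(ℝ, ℂ × ℂ) p).symm
  let d : (ℂ × ℂ) →L[ℝ] (ℂ × ℂ) := mfderiv 𝓘(ℝ, ℂ × ℂ) 𝓘(ℝ, ℂ × ℂ) e y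
  let b : (ℂ × ℂ) →L[ℝ] (ℂ × ℂ) →L[ℝ] ℝ := Ω (e y)
  b.bilinearComp d d

/-- A symplectic form: a smooth, closed, non-degenerate `2`-form. Closedness `dΩ = 0` is written
out in the charts. -/
structure IsSymplecticForm (Ω : BilinField N) : Prop where
  alternating : ∀ (p : N) (u : TangentSpace 𝓘(ℝ, ℂ × ℂ) p), Ω p u u = 0
  nondegenerate : ∀ (p : N) (u : TangentSpace 𝓘(ℝ, ℂ × ℂ) p), (∀ v, Ω p u v = 0) → u = 0
  smooth : ∀ p : N, ContDiffOn ℝ ∞ (Ω.inChart p) (extChartAt 𝓘(ℝ, ℂ × ℂ) p).target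
  closed : ∀ p : N, ∀ y ∈ (extChartAt 𝓘(ℝ, ℂ × ℂ) p).target, ∀ u v w : ℂ × ℂ,
    fderiv ℝ (Ω.inChart p) y u v w + fderiv ℝ (Ω.inChart p) y v w u
      + fderiv ℝ (Ω.inChart p) y w u v = 0

/-- Half of the top exterior power `Ω ∧ Ω`, the volume form that orients a symplectic
`4`-manifold. -/
def BilinField.liouville (Ω : BilinField N) (p : N)
    (u₁ u₂ u₃ u₄ : TangentSpace 𝓘(ℝ, ℂ × ℂ) p) : ℝ :=
  Ω p u₁ u₂ * Ω p u₃ u₄ - Ω p u₁ u₃ * Ω p u₂ u₄ + Ω p u₁ u₄ * Ω p u₂ u₃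

/-- `f : N → N'` preserves the orientations defined by the symplectic forms: its differential takes
positively oriented frames to positively oriented frames. -/
def PreservesOrientation {N' : Type*} [TopologicalSpace N'] [ChartedSpace (ℂ × ℂ) N']
    (Ω : BilinField N) (Ω' : BilinField N') (f : N → N') : Prop :=
  ∀ (p : N) (u₁ u₂ u₃ u₄ : TangentSpace 𝓘(ℝ, ℂ × ℂ) p), 0 < Ω.liouville p u₁ u₂ u₃ u₄ →
    0 < Ω'.liouville (f p)
      (mfderiv 𝓘(ℝ, ℂ × ℂ) 𝓘(ℝ, ℂ × ℂ) f p u₁) (mfderiv 𝓘(ℝ, ℂ × ℂ) 𝓘(ℝ, ℂ × ℂ) f p u₂)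
      (mfderiv 𝓘(ℝ, ℂ × ℂ) 𝓘(ℝ, ℂ × ℂ) f p u₃) (mfderiv 𝓘(ℝ, ℂ × ℂ) 𝓘(ℝ, ℂ × ℂ) f p u₄)

/-- The vector field generating the action of the first circle factor: the velocity at `t = 0` of
`t ↦ (e^{it}, 1) • p`. -/
def gen₁ [MulAction (Circle × Circle) N] (p : N) : TangentSpace 𝓘(ℝ, ℂ × ℂ) p :=
  (mfderiv 𝓘(ℝ, ℝ) 𝓘(ℝ, ℂ × ℂ) (fun t : ℝ => ((Circle.exp t, 1) : Circle × Circle) • p) 0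
    (1 : ℝ) : ℂ × ℂ)

/-- The vector field generating the action of the second circle factor: the velocity at `t = 0` of
`t ↦ (1, e^{it}) • p`. -/
def gen₂ [MulAction (Circle × Circle) N] (p : N) : TangentSpace 𝓘(ℝ, ℂ × ℂ) p :=
  (mfderiv 𝓘(ℝ, ℝ) 𝓘(ℝ, ℂ × ℂ) (fun t : ℝ => ((1, Circle.exp t) : Circle × Circle) • p) 0
    (1 : ℝ) : ℂ × ℂ)

/-- `Φ = (Φ₁, Φ₂)` is a moment map for the action of the torus on `(N, Ω)`:
`dΦⱼ = - Ω (ξⱼ, ·)`, where `ξⱼ` generates the action of the `j`-th circle. -/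
structure IsMomentMap [MulAction (Circle × Circle) N] (Ω : BilinField N) (Φ : N → ℝ × ℝ) :
    Prop where
  smooth : ContMDiff 𝓘(ℝ, ℂ × ℂ) 𝓘(ℝ, ℝ × ℝ) ∞ Φ
  deriv : ∀ (p : N) (u : TangentSpace 𝓘(ℝ, ℂ × ℂ) p),
    (mfderiv 𝓘(ℝ, ℂ × ℂ) 𝓘(ℝ, ℝ × ℝ) Φ p u : ℝ × ℝ) = (- Ω p (gen₁ p) u, - Ω p (gen₂ p) u)

/-- A corner manifold: a connected symplectic `4`-manifold with an effective Hamiltonian action of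
the `2`-torus and a proper moment map whose image lies in the positive quadrant and contains all
points of the quadrant with sufficiently large coordinate sum. -/
structure IsCornerManifold [MulAction (Circle × Circle) N] (Ω : BilinField N) (Φ : N → ℝ × ℝ) :
    Prop where
  hausdorff : T2Space N
  secondCountable : SecondCountableTopology N
  isManifold : IsManifold 𝓘(ℝ, ℂ × ℂ) ∞ N
  connected : ConnectedSpace N
  symplectic : IsSymplecticForm Ω
  smooth_action : ContMDiff (((𝓡 1).prod (𝓡 1)).prod 𝓘(ℝ, ℂ × ℂ)) 𝓘(ℝ, ℂ × ℂ) ∞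
    (fun gp : (Circle × Circle) × N => gp.1 • gp.2)
  effective : FaithfulSMul (Circle × Circle) N
  momentMap : IsMomentMap Ω Φ
  proper : IsProperMap Φ
  image_subset : ∀ p, 0 ≤ (Φ p).1 ∧ 0 ≤ (Φ p).2
  subset_image : ∃ R : ℝ, ∀ w : ℝ × ℝ, 0 ≤ w.1 → 0 ≤ w.2 → R < w.1 + w.2 → w ∈ Set.range Φ

end Symplectic

/-! ### Delzant polyhedral sets -/

/-- The determinant of a pair of vectors in `ℤ²`. -/
def det₂ (u v : ℤ × ℤ) : ℤ := u.1 * v.2 - u.2 * v.1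

/-- The pairing `⟨w, v⟩`. -/
def pairing (w : ℝ × ℝ) (v : ℤ × ℤ) : ℝ := w.1 * v.1 + w.2 * v.2

/-- The data of a Delzant polyhedral set
`Δ = ⋂ i, {w | ⟨w, v i⟩ ≥ a i}` with `n = m + 2` edges (numbered `0, …, m + 1`), where the inward
normals are ordered counter-clockwise, the first is `(1, 0)` and the last is `(0, 1)` with
`a = 0` for both, each `v i` defines a non-trivial edge, and the normals to adjacent edges form a
basis of `ℤ²` (in this order, a positively oriented one; in particular all normals are
primitive). -/
structure CornerPolyhedron (m : ℕ) where
  v : Fin (m + 2) → ℤ × ℤ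
  a : Fin (m + 2) → ℝ
  v_first : v 0 = (1, 0)
  v_last : v (Fin.last (m + 1)) = (0, 1)
  a_first : a 0 = 0
  a_last : a (Fin.last (m + 1)) = 0
  counterclockwise : ∀ i j, i < j → 0 < det₂ (v i) (v j)
  delzant : ∀ k : Fin (m + 1), det₂ (v k.castSucc) (v k.succ) = 1
  nontrivial_edge : ∀ i, {w : ℝ × ℝ | (∀ j, a j ≤ pairing w (v j)) ∧
    pairing w (v i) = a i}.Nontrivial

namespace CornerPolyhedron

variable {m : ℕ} (P : CornerPolyhedron m)

/-- The polyhedral set `Δ`. -/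
def toSet : Set (ℝ × ℝ) := {w | ∀ i, P.a i ≤ pairing w (P.v i)}

/-- The reflection `Δ'` of `Δ` across the diagonal: with the numbering `1, …, n` of the edges,
`v'_i` is `v_{n+1-i}` with its coordinates exchanged, and `a'_i = a_{n+1-i}`. -/
def mirror : CornerPolyhedron m where
  v i := (P.v i.rev).swap
  a i := P.a i.rev
  v_first := by simp [P.v_last]
  v_last := by simp [P.v_first]
  a_first := by simp [P.a_last]
  a_last := by simp [P.a_first]
  counterclockwise i j hij := by
    have := P.counterclockwise j.rev i.rev (by simpa using hij)
    simp only [det₂, Prod.fst_swap, Prod.snd_swap] at *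
    linarith
  delzant k := by
    have := P.delzant k.rev
    rw [Fin.rev_castSucc, Fin.rev_succ]
    simp only [det₂, Prod.fst_swap, Prod.snd_swap] at *
    linarith
  nontrivial_edge i := by
    obtain ⟨w, hw, w', hw', hne⟩ := P.nontrivial_edge i.rev
    have key : ∀ (x : ℝ × ℝ) (u : ℤ × ℤ), pairing x.swap u.swap = pairing x u := by
      intro x u; simp only [pairing, Prod.fst_swap, Prod.snd_swap]; ring
    refine ⟨w.swap, ⟨fun j => ?_, ?_⟩, w'.swap, ⟨fun j => ?_, ?_⟩, ?_⟩
    · rw [key]; exact hw.1 _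
    · rw [key]; exact hw.2
    · rw [key]; exact hw'.1 _
    · rw [key]; exact hw'.2
    · exact fun h => hne (Prod.swap_injective h)

/-! ### The Delzant construction `M_Δ = U_Δ / K` -/

/-- The level set `U_Δ ⊆ ℂⁿ`. (For the first and the last index the equation is trivial.) -/
abbrev Level : Type := {x : Fin (m + 2) → ℂ // ∀ i,
  (1 / 2 : ℝ) * ((P.v i).1 * ‖x 0‖ ^ 2 - ‖x i‖ ^ 2 + (P.v i).2 * ‖x (Fin.last (m + 1))‖ ^ 2) = P.a i}

/-- The standard action of `(S¹)ⁿ` on the level set. -/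
instance : MulAction (Fin (m + 2) → Circle) P.Level where
  smul k x := ⟨fun i => k i * x.1 i, fun i => by simpa only [norm_mul, Circle.norm_coe, one_mul] using x.2 i⟩
  one_smul x := Subtype.ext (funext fun i => by change ((1 : Circle) : ℂ) * _ = _; simp)
  mul_smul k l x := Subtype.ext (funext fun i => by
    change ((k i * l i : Circle) : ℂ) * _ = k i * (l i * x.1 i); simp [mul_assoc])

@[simp] lemma level_smul_apply (k : Fin (m + 2) → Circle) (x : P.Level) (i : Fin (m + 2)) :
    (k • x).1 i = k i * x.1 i := rfl

/-- The subgroup `K ⊆ (S¹)ⁿ`, the kernel of the homomorphism to `(S¹)²` induced by `eᵢ ↦ v i`. -/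
def K : Subgroup (Fin (m + 2) → Circle) where
  carrier := {k | ∏ i, k i ^ (P.v i).1 = 1 ∧ ∏ i, k i ^ (P.v i).2 = 1}
  one_mem' := by simp
  mul_mem' {k l} hk hl := by
    simp only [Set.mem_ofPred_eq, Pi.mul_apply, mul_zpow, Finset.prod_mul_distrib] at *
    simp [hk.1, hk.2, hl.1, hl.2]
  inv_mem' {k} hk := by
    simp only [Set.mem_ofPred_eq, Pi.inv_apply, inv_zpow, Finset.prod_inv_distrib] at *
    simp [hk.1, hk.2]

/-- The reduced space `M_Δ = U_Δ / K`. -/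
def Model : Type := MulAction.orbitRel.Quotient P.K P.Level

instance : TopologicalSpace P.Model :=
  inferInstanceAs (TopologicalSpace (MulAction.orbitRel.Quotient P.K P.Level))

/-- The quotient map `x ↦ [x]`. -/
def quot (x : P.Level) : P.Model := Quotient.mk (MulAction.orbitRel P.K P.Level) x

/-- The standard action of `(S¹)ⁿ` commutes with that of `K`, and so descends to `M_Δ`. -/
def torusMap (k : Fin (m + 2) → Circle) : P.Model → P.Model :=
  Quotient.map (k • ·) (by
    rintro x y ⟨⟨l, hl⟩, rfl⟩
    exact ⟨⟨l, hl⟩, (smul_comm l k y : l • k • y = k • l • y)⟩)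

/-- The element `(λ₁, 1, …, 1, λ₂)` of `(S¹)ⁿ`. -/
def ends (g : Circle × Circle) (i : Fin (m + 2)) : Circle :=
  if i = 0 then g.1 else if i = Fin.last (m + 1) then g.2 else 1

/-- The residual action of `(S¹)²` on `M_Δ`:
`(λ₁, λ₂) • [x₁, …, xₙ] = [λ₁ x₁, x₂, …, xₙ₋₁, λ₂ xₙ]`. -/
instance : MulAction (Circle × Circle) P.Model where
  smul g := P.torusMap (ends g)
  one_smul p := by
    refine Quotient.inductionOn p fun x => ?_
    change P.quot (ends 1 • x) = P.quot x
    have : ends (m := m) 1 = 1 := by ext i; simp [ends]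
    rw [this, one_smul]
  mul_smul g h p := by
    refine Quotient.inductionOn p fun x => ?_
    change P.quot (ends (g * h) • x) = P.quot (ends g • ends h • x)
    have : ends (m := m) (g * h) = ends g * ends h := by
      ext i; simp only [ends, Pi.mul_apply]; split_ifs <;> simp
    rw [this, mul_smul]

/-- The moment map `[x] ↦ (|x₁|², |xₙ|²) / 2` on `M_Δ`. -/
def modelMoment : P.Model → ℝ × ℝ :=
  Quotient.lift (fun x : P.Level => ((1 / 2 : ℝ) * ‖x.1 0‖ ^ 2,
    (1 / 2 : ℝ) * ‖x.1 (Fin.last (m + 1))‖ ^ 2)) (by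
    rintro x y ⟨⟨l, hl⟩, rfl⟩
    change ((1 / 2 : ℝ) * ‖(l 0 : ℂ) * y.1 0‖ ^ 2,
      (1 / 2 : ℝ) * ‖(l (Fin.last (m + 1)) : ℂ) * y.1 (Fin.last (m + 1))‖ ^ 2) = _
    simp only [norm_mul, Circle.norm_coe, one_mul])

/-- For two indices `i`, `i'`, the map
`x ↦ (xᵢ ∏ⱼ (xⱼ / |xⱼ|) ^ det (vⱼ, v_{i'}), x_{i'} ∏ⱼ (xⱼ / |xⱼ|) ^ det (vᵢ, vⱼ))`,
where `j` runs through the indices other than `i` and `i'`. When `det (vᵢ, v_{i'}) = 1`, the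
exponents are the coordinates of `vⱼ` in the basis `vᵢ, v_{i'}`. -/
def coords (i i' : Fin (m + 2)) (x : Fin (m + 2) → ℂ) : ℂ × ℂ :=
  (x i * ∏ j ∈ ({i, i'} : Finset (Fin (m + 2)))ᶜ, (x j / ‖x j‖) ^ det₂ (P.v j) (P.v i'),
   x i' * ∏ j ∈ ({i, i'} : Finset (Fin (m + 2)))ᶜ, (x j / ‖x j‖) ^ det₂ (P.v i) (P.v j))

lemma prod_circle_of_mem_K {k : Fin (m + 2) → Circle} (hk : k ∈ P.K) (c d : ℤ) :
    ∏ j, k j ^ (c * (P.v j).1 + d * (P.v j).2) = 1 := by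
  have h1 := hk.1
  have h2 := hk.2
  simp only [zpow_add, mul_comm c, mul_comm d, zpow_mul, Finset.prod_mul_distrib,
    Finset.prod_zpow, h1, h2, one_zpow, mul_one]

lemma prod_split {M : Type*} [CommMonoid M] {i i' : Fin (m + 2)} (h : i ≠ i')
    (f : Fin (m + 2) → M) :
    ∏ j, f j = f i * f i' * ∏ j ∈ ({i, i'} : Finset (Fin (m + 2)))ᶜ, f j := by
  rw [← Finset.prod_mul_prod_compl {i, i'} f, Finset.prod_pair h]

lemma ne_of_det {i i' : Fin (m + 2)} (h : det₂ (P.v i) (P.v i') = 1) : i ≠ i' := by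
  rintro rfl; simp [det₂, mul_comm] at h

lemma coords_smul {i i' : Fin (m + 2)} (h : det₂ (P.v i) (P.v i') = 1)
    {k : Fin (m + 2) → Circle} (hk : k ∈ P.K) (x : P.Level) :
    P.coords i i' (k • x).1 = P.coords i i' x.1 := by
  have hne := P.ne_of_det h
  have e1 := P.prod_circle_of_mem_K hk (P.v i').2 (-(P.v i').1)
  have e2 := P.prod_circle_of_mem_K hk (-(P.v i).2) (P.v i).1
  have r1 : ∀ j, (P.v i').2 * (P.v j).1 + -(P.v i').1 * (P.v j).2 = det₂ (P.v j) (P.v i') := by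
    intro j; simp only [det₂]; ring
  have r2 : ∀ j, -(P.v i).2 * (P.v j).1 + (P.v i).1 * (P.v j).2 = det₂ (P.v i) (P.v j) := by
    intro j; simp only [det₂]; ring
  simp only [r1] at e1
  simp only [r2] at e2
  rw [prod_split hne] at e1 e2
  have z : ∀ w, det₂ w w = 0 := fun w => by simp [det₂, mul_comm]
  simp only [h, z, zpow_one, zpow_zero, mul_one, one_mul] at e1 e2
  have e1' := congrArg (fun c : Circle => (c : ℂ)) e1
  have e2' := congrArg (fun c : Circle => (c : ℂ)) e2
  simp only [Circle.coe_mul, Circle.coe_one] at e1' e2'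
  have pr : ∀ (s : Finset (Fin (m + 2))) (c : Fin (m + 2) → ℤ),
      ∏ j ∈ s, ((k j * x.1 j : ℂ) / ‖(k j * x.1 j : ℂ)‖) ^ c j
      = ((∏ j ∈ s, k j ^ c j : Circle) : ℂ) * ∏ j ∈ s, (x.1 j / ‖x.1 j‖) ^ c j := by
    intro s c
    have e : ((∏ j ∈ s, k j ^ c j : Circle) : ℂ) = ∏ j ∈ s, (k j : ℂ) ^ c j :=
      (map_prod Circle.coeHom _ s).trans (Finset.prod_congr rfl fun j _ => Circle.coe_zpow _ _)
    rw [e]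
    rw [← Finset.prod_mul_distrib]
    refine Finset.prod_congr rfl fun j _ => ?_
    rw [norm_mul, Circle.norm_coe, one_mul, mul_div_assoc, mul_zpow]
  simp only [coords, level_smul_apply, pr]
  refine Prod.ext ?_ ?_
  · simp only
    linear_combination (x.1 i * ∏ j ∈ ({i, i'} : Finset (Fin (m + 2)))ᶜ,
      (x.1 j / ‖x.1 j‖) ^ det₂ (P.v j) (P.v i')) * e1'
  · simp only
    linear_combination (x.1 i' * ∏ j ∈ ({i, i'} : Finset (Fin (m + 2)))ᶜ,
      (x.1 j / ‖x.1 j‖) ^ det₂ (P.v i) (P.v j)) * e2'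

/-- The map on `M_Δ` induced by `coords`. -/
def modelCoords (i i' : Fin (m + 2)) (h : det₂ (P.v i) (P.v i') = 1) : P.Model → ℂ × ℂ :=
  Quotient.lift (fun x : P.Level => P.coords i i' x.1) (by
    rintro x y ⟨⟨l, hl⟩, rfl⟩
    exact P.coords_smul h hl y)

/-- The symplectic blowup map on `M_Δ`. Since `v₁ = (1, 0)` and `vₙ = (0, 1)`, the exponents are
the coordinates of `v_j = (α_j, β_j)`:
`ψ [x] = (x₁ ∏ⱼ (xⱼ / |xⱼ|) ^ α_j, xₙ ∏ⱼ (xⱼ / |xⱼ|) ^ β_j)`, with `1 < j < n`.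
Its values where some of these `xⱼ` vanishes are irrelevant. -/
def modelBlowup : P.Model → ℂ × ℂ :=
  P.modelCoords 0 (Fin.last (m + 1)) (by simp [P.v_first, P.v_last, det₂])

/-! #### Smooth structure of `M_Δ`

For each vertex of `Δ`, where the edges `k` and `k + 1` meet, the map `coords k (k + 1)` is a chart
on the set of points `[x]` with `x_j ≠ 0` for all other `j`. -/

/-- The point `w ∈ ℝ²` with `⟨w, v_k⟩ - a_k = |z₁|² / 2` and
`⟨w, v_{k+1}⟩ - a_{k+1} = |z₂|² / 2`. -/
def vertexMoment (k : Fin (m + 1)) (z : ℂ × ℂ) : ℝ × ℝ :=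
  let s := P.a k.castSucc + (1 / 2 : ℝ) * ‖z.1‖ ^ 2
  let t := P.a k.succ + (1 / 2 : ℝ) * ‖z.2‖ ^ 2
  (s * (P.v k.succ).2 - t * (P.v k.castSucc).2, -s * (P.v k.succ).1 + t * (P.v k.castSucc).1)

lemma vertexMoment_castSucc (k : Fin (m + 1)) (z : ℂ × ℂ) :
    pairing (P.vertexMoment k z) (P.v k.castSucc) = P.a k.castSucc + (1 / 2 : ℝ) * ‖z.1‖ ^ 2 := by
  have h : ((det₂ (P.v k.castSucc) (P.v k.succ) : ℤ) : ℝ) = 1 := by rw [P.delzant k]; simp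
  simp only [det₂] at h
  push_cast at h
  simp only [pairing, vertexMoment]
  linear_combination (P.a k.castSucc + (1 / 2 : ℝ) * ‖z.1‖ ^ 2) * h

lemma vertexMoment_succ (k : Fin (m + 1)) (z : ℂ × ℂ) :
    pairing (P.vertexMoment k z) (P.v k.succ) = P.a k.succ + (1 / 2 : ℝ) * ‖z.2‖ ^ 2 := by
  have h : ((det₂ (P.v k.castSucc) (P.v k.succ) : ℤ) : ℝ) = 1 := by rw [P.delzant k]; simp
  simp only [det₂] at h
  push_cast at h
  simp only [pairing, vertexMoment]
  linear_combination (P.a k.succ + (1 / 2 : ℝ) * ‖z.2‖ ^ 2) * h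

/-- The image of the chart at the `k`-th vertex. -/
def vertexTarget (k : Fin (m + 1)) : Set (ℂ × ℂ) :=
  {z | ∀ j, j ≠ k.castSucc → j ≠ k.succ → P.a j < pairing (P.vertexMoment k z) (P.v j)}

/-- The point of `U_Δ` over `z` at which all coordinates other than the `k`-th and the `(k + 1)`-st
are positive real numbers. -/
def vertexSection (k : Fin (m + 1)) (z : ℂ × ℂ) (j : Fin (m + 2)) : ℂ :=
  if j = k.castSucc then z.1 else if j = k.succ then z.2 else
    (Real.sqrt (2 * (pairing (P.vertexMoment k z) (P.v j) - P.a j)) : ℂ)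

lemma half_norm_vertexSection {k : Fin (m + 1)} {z : ℂ × ℂ} (hz : z ∈ P.vertexTarget k)
    (j : Fin (m + 2)) : (1 / 2 : ℝ) * ‖P.vertexSection k z j‖ ^ 2
      = pairing (P.vertexMoment k z) (P.v j) - P.a j := by
  unfold vertexSection
  split_ifs with h1 h2
  · subst h1; rw [vertexMoment_castSucc]; ring
  · subst h2; rw [vertexMoment_succ]; ring
  · have := hz j h1 h2
    rw [Complex.norm_real, Real.norm_eq_abs, sq_abs, Real.sq_sqrt (by linarith)]; ring

lemma vertexSection_mem {k : Fin (m + 1)} {z : ℂ × ℂ} (hz : z ∈ P.vertexTarget k)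
    (i : Fin (m + 2)) :
    (1 / 2 : ℝ) * ((P.v i).1 * ‖P.vertexSection k z 0‖ ^ 2 - ‖P.vertexSection k z i‖ ^ 2 +
      (P.v i).2 * ‖P.vertexSection k z (Fin.last (m + 1))‖ ^ 2) = P.a i := by
  have h0 := P.half_norm_vertexSection hz 0
  have h1 := P.half_norm_vertexSection hz (Fin.last (m + 1))
  have h2 := P.half_norm_vertexSection hz i
  simp only [pairing, P.v_first, P.v_last, P.a_first, P.a_last] at h0 h1 h2
  push_cast at h0 h1
  linear_combination ((P.v i).1 : ℝ) * h0 + ((P.v i).2 : ℝ) * h1 - h2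

instance : Nonempty P.Model := by
  obtain ⟨w, ⟨hw, -⟩, -⟩ := P.nontrivial_edge 0
  have key : ∀ i, ‖((Real.sqrt (2 * (pairing w (P.v i) - P.a i)) : ℝ) : ℂ)‖ ^ 2 =
      2 * (pairing w (P.v i) - P.a i) := by
    intro i
    rw [Complex.norm_real, Real.norm_eq_abs, sq_abs, Real.sq_sqrt (by linarith [hw i])]
  refine ⟨P.quot ⟨fun i => (Real.sqrt (2 * (pairing w (P.v i) - P.a i)) : ℂ), fun i => ?_⟩⟩
  simp only [key]
  simp only [pairing, P.v_first, P.v_last, P.a_first, P.a_last]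
  push_cast
  ring

open Classical in
/-- The inverse of the chart at the `k`-th vertex, `z ↦ [vertexSection k z]`. -/
def vertexInv (k : Fin (m + 1)) (z : ℂ × ℂ) : P.Model :=
  if hz : z ∈ P.vertexTarget k then P.quot ⟨P.vertexSection k z, P.vertexSection_mem hz⟩
  else Classical.arbitrary _

lemma vertexInv_of_mem {k : Fin (m + 1)} {z : ℂ × ℂ} (hz : z ∈ P.vertexTarget k) :
    P.vertexInv k z = P.quot ⟨P.vertexSection k z, P.vertexSection_mem hz⟩ := dif_pos hz

/-- The domain of the chart at the `k`-th vertex: all `x_j`, `j ≠ k, k + 1`, are non-zero. -/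
def vertexSource (k : Fin (m + 1)) : Set P.Model :=
  P.quot '' {x | ∀ j, j ≠ k.castSucc → j ≠ k.succ → x.1 j ≠ 0}

lemma quot_eq_iff {x y : P.Level} : P.quot x = P.quot y ↔ ∃ k ∈ P.K, k • y = x := by
  constructor
  · intro h
    obtain ⟨⟨k, hk⟩, h⟩ := Quotient.exact h
    exact ⟨k, hk, h⟩
  · rintro ⟨k, hk, rfl⟩
    exact Quotient.sound ⟨⟨k, hk⟩, rfl⟩

lemma quot_mem_vertexSource {k : Fin (m + 1)} {x : P.Level} :
    P.quot x ∈ P.vertexSource k ↔ ∀ j, j ≠ k.castSucc → j ≠ k.succ → x.1 j ≠ 0 := by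
  constructor
  · rintro ⟨y, hy, h⟩ j h1 h2
    obtain ⟨l, -, rfl⟩ := P.quot_eq_iff.1 h
    have := hy j h1 h2
    rw [level_smul_apply] at this
    exact right_ne_zero_of_mul this
  · exact fun h => ⟨x, h, rfl⟩

lemma continuous_quot : Continuous P.quot := continuous_quot_mk

lemma isOpenMap_quot : IsOpenMap P.quot := by
  have : ContinuousConstSMul P.K P.Level := ⟨fun k => by
    refine Continuous.subtype_mk (continuous_pi fun i => ?_) _
    exact continuous_const.mul ((continuous_apply i).comp continuous_subtype_val)⟩
  exact isOpenMap_quotient_mk'_mul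

lemma quot_surjective : Function.Surjective P.quot := Quotient.mk_surjective

/-- The phase `c / |c|` of `c ≠ 0`. -/
def phase (c : ℂ) : Circle := Circle.exp c.arg

lemma coe_phase {c : ℂ} (hc : c ≠ 0) : (phase c : ℂ) = c / ‖c‖ := by
  have : (‖c‖ : ℂ) ≠ 0 := by simpa using hc
  rw [eq_div_iff this, phase, Circle.coe_exp, mul_comm]
  exact Complex.norm_mul_exp_arg_mul_I c

lemma coe_prod_phase {s : Finset (Fin (m + 2))} {x : Fin (m + 2) → ℂ} (hx : ∀ j ∈ s, x j ≠ 0)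
    (c : Fin (m + 2) → ℤ) :
    ∏ j ∈ s, (x j / ‖x j‖) ^ c j = ((∏ j ∈ s, phase (x j) ^ c j : Circle) : ℂ) := by
  have e : ((∏ j ∈ s, phase (x j) ^ c j : Circle) : ℂ) = ∏ j ∈ s, (phase (x j) : ℂ) ^ c j :=
    (map_prod Circle.coeHom _ s).trans (Finset.prod_congr rfl fun j _ => Circle.coe_zpow _ _)
  rw [e]
  exact Finset.prod_congr rfl fun j hj => by rw [coe_phase (hx j hj)]

lemma half_norm_level (x : P.Level) (i : Fin (m + 2)) : (1 / 2 : ℝ) * ‖x.1 i‖ ^ 2 =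
    pairing ((1 / 2 : ℝ) * ‖x.1 0‖ ^ 2, (1 / 2 : ℝ) * ‖x.1 (Fin.last (m + 1))‖ ^ 2) (P.v i)
      - P.a i := by
  have := x.2 i
  simp only [pairing]
  linear_combination -this

lemma vertexMoment_eq {k : Fin (m + 1)} {z : ℂ × ℂ} {w : ℝ × ℝ}
    (h1 : pairing w (P.v k.castSucc) = P.a k.castSucc + (1 / 2 : ℝ) * ‖z.1‖ ^ 2)
    (h2 : pairing w (P.v k.succ) = P.a k.succ + (1 / 2 : ℝ) * ‖z.2‖ ^ 2) :
    P.vertexMoment k z = w := by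
  have h : ((det₂ (P.v k.castSucc) (P.v k.succ) : ℤ) : ℝ) = 1 := by rw [P.delzant k]; simp
  simp only [det₂] at h
  push_cast at h
  simp only [vertexMoment, ← h1, ← h2, pairing]
  refine Prod.ext ?_ ?_
  · simp only; linear_combination w.1 * h
  · simp only; linear_combination w.2 * h

lemma mem_compl_pair {i i' j : Fin (m + 2)} :
    j ∈ ({i, i'} : Finset (Fin (m + 2)))ᶜ ↔ j ≠ i ∧ j ≠ i' := by simp

lemma coords_eq {k : Fin (m + 1)} {x : Fin (m + 2) → ℂ}
    (hx : ∀ j, j ≠ k.castSucc → j ≠ k.succ → x j ≠ 0) :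
    P.coords k.castSucc k.succ x =
      (x k.castSucc * (∏ j ∈ ({k.castSucc, k.succ} : Finset (Fin (m + 2)))ᶜ,
        phase (x j) ^ det₂ (P.v j) (P.v k.succ) : Circle),
       x k.succ * (∏ j ∈ ({k.castSucc, k.succ} : Finset (Fin (m + 2)))ᶜ,
        phase (x j) ^ det₂ (P.v k.castSucc) (P.v j) : Circle)) := by
  have hx' : ∀ j ∈ ({k.castSucc, k.succ} : Finset (Fin (m + 2)))ᶜ, x j ≠ 0 :=
    fun j hj => hx j (mem_compl_pair.1 hj).1 (mem_compl_pair.1 hj).2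
  rw [coords, coe_prod_phase hx', coe_prod_phase hx']

lemma vertexMoment_coords {k : Fin (m + 1)} {x : P.Level}
    (hx : ∀ j, j ≠ k.castSucc → j ≠ k.succ → x.1 j ≠ 0) :
    P.vertexMoment k (P.coords k.castSucc k.succ x.1) =
      ((1 / 2 : ℝ) * ‖x.1 0‖ ^ 2, (1 / 2 : ℝ) * ‖x.1 (Fin.last (m + 1))‖ ^ 2) := by
  apply P.vertexMoment_eq
  · rw [P.coords_eq hx]
    simp only [norm_mul, Circle.norm_coe, mul_one]
    linarith [P.half_norm_level x k.castSucc]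
  · rw [P.coords_eq hx]
    simp only [norm_mul, Circle.norm_coe, mul_one]
    linarith [P.half_norm_level x k.succ]

lemma coords_mem {k : Fin (m + 1)} {x : P.Level}
    (hx : ∀ j, j ≠ k.castSucc → j ≠ k.succ → x.1 j ≠ 0) :
    P.coords k.castSucc k.succ x.1 ∈ P.vertexTarget k := by
  intro j h1 h2
  rw [P.vertexMoment_coords hx]
  have := P.half_norm_level x j
  have : 0 < ‖x.1 j‖ := norm_pos_iff.2 (hx j h1 h2)
  have : 0 < (1 / 2 : ℝ) * ‖x.1 j‖ ^ 2 := by positivity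
  linarith

lemma vertexSection_ne_zero {k : Fin (m + 1)} {z : ℂ × ℂ} (hz : z ∈ P.vertexTarget k)
    (j : Fin (m + 2)) (h1 : j ≠ k.castSucc) (h2 : j ≠ k.succ) : P.vertexSection k z j ≠ 0 := by
  have := hz j h1 h2
  intro h0
  have := P.half_norm_vertexSection hz j
  rw [h0] at this
  simp at this
  linarith

lemma coords_vertexSection {k : Fin (m + 1)} {z : ℂ × ℂ} (hz : z ∈ P.vertexTarget k) :
    P.coords k.castSucc k.succ (P.vertexSection k z) = z := by
  have ph : ∀ j ∈ ({k.castSucc, k.succ} : Finset (Fin (m + 2)))ᶜ,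
      P.vertexSection k z j / ‖P.vertexSection k z j‖ = 1 := by
    intro j hj
    obtain ⟨h1, h2⟩ := mem_compl_pair.1 hj
    have hne := P.vertexSection_ne_zero hz j h1 h2
    simp only [vertexSection, if_neg h1, if_neg h2] at hne ⊢
    rw [Complex.norm_real, Real.norm_eq_abs, abs_of_nonneg (Real.sqrt_nonneg _), div_self hne]
  have pr : ∀ c : Fin (m + 2) → ℤ, ∏ j ∈ ({k.castSucc, k.succ} : Finset (Fin (m + 2)))ᶜ,
      (P.vertexSection k z j / ‖P.vertexSection k z j‖) ^ c j = 1 := fun c =>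
    Finset.prod_eq_one fun j hj => by rw [ph j hj, one_zpow]
  rw [coords, pr, pr]
  simp [vertexSection, k.castSucc_lt_succ.ne']

lemma vertexSection_coords {k : Fin (m + 1)} {x : P.Level}
    (hx : ∀ j, j ≠ k.castSucc → j ≠ k.succ → x.1 j ≠ 0) :
    P.quot ⟨_, P.vertexSection_mem (P.coords_mem hx)⟩ = P.quot x := by
  set s := ({k.castSucc, k.succ} : Finset (Fin (m + 2)))ᶜ
  set A : Circle := ∏ j ∈ s, phase (x.1 j) ^ det₂ (P.v j) (P.v k.succ) with hA
  set B : Circle := ∏ j ∈ s, phase (x.1 j) ^ det₂ (P.v k.castSucc) (P.v j) with hB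
  have hne := k.castSucc_lt_succ.ne
  have hdet := P.delzant k
  rw [quot_eq_iff]
  let l : Fin (m + 2) → Circle := fun j =>
    if j = k.castSucc then A else if j = k.succ then B else (phase (x.1 j))⁻¹
  have l1 : l k.castSucc = A := if_pos rfl
  have l2 : l k.succ = B := by simp [l, hne.symm]
  have l3 : ∀ j ∈ s, l j = (phase (x.1 j))⁻¹ := fun j hj => by
    simp [l, (mem_compl_pair.1 hj).1, (mem_compl_pair.1 hj).2]
  have prod : ∀ f : Fin (m + 2) → ℤ,
      (∀ j, f j = det₂ (P.v j) (P.v k.succ) * f k.castSucc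
        + det₂ (P.v k.castSucc) (P.v j) * f k.succ) → ∏ j, l j ^ f j = 1 := by
    intro f hf
    rw [prod_split hne, l1, l2, hA, hB, ← Finset.prod_zpow, ← Finset.prod_zpow,
      ← Finset.prod_mul_distrib, ← Finset.prod_mul_distrib]
    refine Finset.prod_eq_one fun j hj => ?_
    rw [l3 j hj, ← zpow_mul, ← zpow_mul, ← zpow_add, ← hf j, inv_zpow, mul_inv_cancel]
  refine ⟨l, ⟨prod _ fun j => ?_, prod _ fun j => ?_⟩, ?_⟩
  · simp only [det₂] at hdet ⊢
    linear_combination -(P.v j).1 * hdet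
  · simp only [det₂] at hdet ⊢
    linear_combination -(P.v j).2 * hdet
  · refine Subtype.ext (funext fun j => ?_)
    rw [level_smul_apply]
    change (l j : ℂ) * x.1 j = P.vertexSection k (P.coords k.castSucc k.succ x.1) j
    by_cases h1 : j = k.castSucc
    · subst h1
      rw [l1, P.coords_eq hx]
      simp only [vertexSection, if_true]
      rw [mul_comm]
    by_cases h2 : j = k.succ
    · subst h2
      rw [l2, P.coords_eq hx]
      simp only [vertexSection, if_true, if_neg hne.symm]
      rw [mul_comm]
    · rw [l3 j (mem_compl_pair.2 ⟨h1, h2⟩)]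
      simp only [vertexSection, if_neg h1, if_neg h2, P.vertexMoment_coords hx,
        ← P.half_norm_level x j]
      have hx0 := hx j h1 h2
      have hn : (‖x.1 j‖ : ℂ) ≠ 0 := by simpa using hx0
      rw [show 2 * ((1 / 2 : ℝ) * ‖x.1 j‖ ^ 2) = ‖x.1 j‖ ^ 2 by ring,
        Real.sqrt_sq (norm_nonneg _), Circle.coe_inv, coe_phase hx0]
      field_simp

/-- Where the coordinates with the indices `≠ i, i'` do not vanish. -/
def nonvanishing (i i' : Fin (m + 2)) : Set (Fin (m + 2) → ℂ) :=
  {x | ∀ j, j ≠ i → j ≠ i' → x j ≠ 0}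

lemma contDiffOn_coords (i i' : Fin (m + 2)) :
    ContDiffOn ℝ ∞ (P.coords i i') (nonvanishing i i') := by
  intro x hx
  refine ContDiffAt.contDiffWithinAt ?_
  have ap : ∀ j, ContDiffAt ℝ ∞ (fun y : Fin (m + 2) → ℂ => y j) x := fun j =>
    (contDiff_apply ℝ ℂ j).contDiffAt
  have ph : ∀ (c : ℤ), ∀ j ∈ ({i, i'} : Finset (Fin (m + 2)))ᶜ,
      ContDiffAt ℝ ∞ (fun y : Fin (m + 2) → ℂ => (y j / ‖y j‖) ^ c) x := by
    intro c j hj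
    have hx0 : x j ≠ 0 := hx j (mem_compl_pair.1 hj).1 (mem_compl_pair.1 hj).2
    have hn : (‖x j‖ : ℂ) ≠ 0 := by simpa using hx0
    have z : ContDiffAt ℝ ∞ (fun y : ℂ => y ^ c) (x j / ‖x j‖) :=
      ((analyticAt_id.zpow (n := c) (div_ne_zero hx0 hn)).contDiffAt (𝕜 := ℂ)).restrict_scalars ℝ
    have n1 : ContDiffAt ℝ ∞ (fun y : Fin (m + 2) → ℂ => ‖y j‖⁻¹) x :=
      ((ap j).norm ℝ hx0).inv (norm_ne_zero_iff.2 hx0)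
    have n2 : ContDiffAt ℝ ∞ (fun y : Fin (m + 2) → ℂ => y j / ‖y j‖) x := by
      refine (n1.smul (ap j)).congr_of_eventuallyEq (Filter.Eventually.of_forall fun y => ?_)
      simp [div_eq_inv_mul]
    exact z.comp x n2
  exact ((ap i).mul (contDiffAt_prod fun j hj => ph _ j hj)).prodMk
    ((ap i').mul (contDiffAt_prod fun j hj => ph _ j hj))

lemma contDiff_vertexMoment (k : Fin (m + 1)) (u : ℤ × ℤ) :
    ContDiff ℝ ∞ (fun z => pairing (P.vertexMoment k z) u) := by
  have h1 : ContDiff ℝ ∞ (fun z : ℂ × ℂ => ‖z.1‖ ^ 2) := contDiff_fst.norm_sq ℝ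
  have h2 : ContDiff ℝ ∞ (fun z : ℂ × ℂ => ‖z.2‖ ^ 2) := contDiff_snd.norm_sq ℝ
  simp only [pairing, vertexMoment]
  fun_prop

lemma isOpen_vertexTarget (k : Fin (m + 1)) : IsOpen (P.vertexTarget k) := by
  have : P.vertexTarget k = ⋂ j, ⋂ (_ : j ≠ k.castSucc), ⋂ (_ : j ≠ k.succ),
      {z | P.a j < pairing (P.vertexMoment k z) (P.v j)} := by
    ext z; simp [vertexTarget]
  rw [this]
  refine isOpen_iInter_of_finite fun j => isOpen_iInter_of_finite fun _ =>
    isOpen_iInter_of_finite fun _ => ?_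
  exact isOpen_lt continuous_const (P.contDiff_vertexMoment k (P.v j)).continuous

lemma contDiffOn_vertexSection (k : Fin (m + 1)) :
    ContDiffOn ℝ ∞ (P.vertexSection k) (P.vertexTarget k) := by
  intro z hz
  refine ContDiffAt.contDiffWithinAt (contDiffAt_pi.2 fun j => ?_)
  unfold vertexSection
  by_cases h1 : j = k.castSucc
  · simp only [if_pos h1]; exact contDiffAt_fst
  by_cases h2 : j = k.succ
  · simp only [if_neg h1, if_pos h2]; exact contDiffAt_snd
  simp only [if_neg h1, if_neg h2]
  have : ContDiffAt ℝ ∞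
      (fun z => Real.sqrt (2 * (pairing (P.vertexMoment k z) (P.v j) - P.a j))) z := by
    refine ContDiffAt.sqrt ?_ ?_
    · exact (contDiff_const.mul ((P.contDiff_vertexMoment k (P.v j)).sub contDiff_const)).contDiffAt
    · have := hz j h1 h2
      exact ne_of_gt (by linarith)
  exact Complex.ofRealCLM.contDiff.contDiffAt.comp z this

/-- The chart of `M_Δ` at the `k`-th vertex. -/
def vertexChart (k : Fin (m + 1)) : OpenPartialHomeomorph P.Model (ℂ × ℂ) where
  toFun := P.modelCoords k.castSucc k.succ (P.delzant k)
  invFun := P.vertexInv k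
  source := P.vertexSource k
  target := P.vertexTarget k
  map_source' := by
    rintro _ ⟨x, hx, rfl⟩
    exact P.coords_mem hx
  map_target' := fun z hz => by
    rw [P.vertexInv_of_mem hz, quot_mem_vertexSource]
    exact P.vertexSection_ne_zero hz
  left_inv' := by
    rintro _ ⟨x, hx, rfl⟩
    exact (P.vertexInv_of_mem (P.coords_mem hx)).trans (P.vertexSection_coords hx)
  right_inv' := fun z hz => by
    rw [P.vertexInv_of_mem hz]
    exact P.coords_vertexSection hz
  open_source := by
    refine P.isOpenMap_quot _ ?_
    have : {x : P.Level | ∀ j, j ≠ k.castSucc → j ≠ k.succ → x.1 j ≠ 0} =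
        ⋂ j, ⋂ (_ : j ≠ k.castSucc), ⋂ (_ : j ≠ k.succ), {x | x.1 j ≠ 0} := by
      ext x; simp
    rw [this]
    refine isOpen_iInter_of_finite fun j => isOpen_iInter_of_finite fun _ =>
      isOpen_iInter_of_finite fun _ => ?_
    exact isOpen_ne_fun ((continuous_apply j).comp continuous_subtype_val) continuous_const
  open_target := P.isOpen_vertexTarget k
  continuousOn_toFun := by
    have hq : Topology.IsQuotientMap P.quot :=
      P.isOpenMap_quot.isQuotientMap P.continuous_quot P.quot_surjective
    rw [continuousOn_iff_continuous_domRestrict]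
    have hq' := (P.isOpenMap_quot.restrictPreimage (P.vertexSource k)).isQuotientMap
      (P.continuous_quot.restrictPreimage)
      (Set.restrictPreimage_surjective _ P.quot_surjective)
    rw [hq'.continuous_iff]
    have hc := (P.contDiffOn_coords k.castSucc k.succ).continuousOn
    refine hc.comp_continuous
      (f := fun x : P.quot ⁻¹' P.vertexSource k => x.1.1)
      (continuous_subtype_val.comp continuous_subtype_val) fun x => ?_
    exact P.quot_mem_vertexSource.1 x.2
  continuousOn_invFun := by
    rw [continuousOn_iff_continuous_domRestrict]
    have hc := continuousOn_iff_continuous_domRestrict.1 (P.contDiffOn_vertexSection k).continuousOn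
    have : (P.vertexTarget k).domRestrict (P.vertexInv k) = fun z =>
        P.quot ⟨P.vertexSection k z.1, P.vertexSection_mem z.2⟩ :=
      funext fun z => P.vertexInv_of_mem z.2
    rw [this]
    exact P.continuous_quot.comp (hc.subtype_mk _)

/-- If two edges meet in a point of `Δ`, they are adjacent. -/
lemma adjacent_of_mem {w : ℝ × ℝ} (hw : w ∈ P.toSet) {i j : Fin (m + 2)} (hij : i < j)
    (hi : pairing w (P.v i) = P.a i) (hj : pairing w (P.v j) = P.a j) : j.1 = i.1 + 1 := by
  by_contra hne
  have hlt : i.1 + 1 < j.1 := by have := Fin.lt_def.1 hij; omega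
  let l : Fin (m + 2) := ⟨i.1 + 1, by omega⟩
  have hil : i < l := Fin.lt_def.2 (by simp [l])
  have hlj : l < j := Fin.lt_def.2 (by simpa [l] using hlt)
  have dij : (0 : ℝ) < det₂ (P.v i) (P.v j) := by exact_mod_cast P.counterclockwise _ _ hij
  have dil : (0 : ℝ) < det₂ (P.v i) (P.v l) := by exact_mod_cast P.counterclockwise _ _ hil
  have dlj : (0 : ℝ) < det₂ (P.v l) (P.v j) := by exact_mod_cast P.counterclockwise _ _ hlj
  have expand : ∀ x : ℝ × ℝ, (det₂ (P.v i) (P.v j) : ℝ) * pairing x (P.v l) =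
      det₂ (P.v l) (P.v j) * pairing x (P.v i) + det₂ (P.v i) (P.v l) * pairing x (P.v j) := by
    intro x; simp only [det₂, pairing]; push_cast; ring
  have solve : ∀ x : ℝ × ℝ, pairing x (P.v i) = P.a i → pairing x (P.v j) = P.a j → x = w := by
    intro x h1 h2
    rw [← hi] at h1
    rw [← hj] at h2
    simp only [pairing, det₂] at *
    push_cast at dij
    refine Prod.ext ?_ ?_
    · refine mul_left_cancel₀ dij.ne' ?_
      linear_combination ((P.v j).2 : ℝ) * h1 - ((P.v i).2 : ℝ) * h2
    · refine mul_left_cancel₀ dij.ne' ?_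
      linear_combination ((P.v i).1 : ℝ) * h2 - ((P.v j).1 : ℝ) * h1
  have only : ∀ x : ℝ × ℝ, (∀ s, P.a s ≤ pairing x (P.v s)) → pairing x (P.v l) = P.a l →
      x = w := by
    intro x hx hxl
    have e1 := expand x
    have e2 := expand w
    have hwl := hw l
    rw [hi, hj] at e2
    rw [hxl] at e1
    have h1 := hx i
    have h2 := hx j
    have m1 := mul_le_mul_of_nonneg_left hwl dij.le
    have m2 := mul_le_mul_of_nonneg_left h1 dlj.le
    have m3 := mul_le_mul_of_nonneg_left h2 dil.le
    refine solve x ?_ ?_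
    · exact (mul_left_cancel₀ dlj.ne' (by linarith)).symm
    · exact (mul_left_cancel₀ dil.ne' (by linarith)).symm
  obtain ⟨x, hx, y, hy, hxy⟩ := P.nontrivial_edge l
  exact hxy ((only x hx.1 hx.2).trans (only y hy.1 hy.2).symm)

lemma exists_vertexSource (p : P.Model) : ∃ k, p ∈ P.vertexSource k := by
  obtain ⟨x, rfl⟩ := P.quot_surjective p
  simp only [quot_mem_vertexSource]
  set w : ℝ × ℝ := ((1 / 2 : ℝ) * ‖x.1 0‖ ^ 2, (1 / 2 : ℝ) * ‖x.1 (Fin.last (m + 1))‖ ^ 2)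
  have hw : w ∈ P.toSet := fun i => by
    have := P.half_norm_level x i
    have : 0 ≤ (1 / 2 : ℝ) * ‖x.1 i‖ ^ 2 := by positivity
    linarith
  have hz : ∀ i, x.1 i = 0 → pairing w (P.v i) = P.a i := fun i h0 => by
    have := P.half_norm_level x i
    rw [h0] at this
    simp only [norm_zero] at this
    linarith
  by_contra! hcon
  have adj : ∀ i j, i < j → x.1 i = 0 → x.1 j = 0 → j.1 = i.1 + 1 :=
    fun i j hij h1 h2 => P.adjacent_of_mem hw hij (hz i h1) (hz j h2)
  obtain ⟨j₀, -, -, h₀⟩ := hcon 0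
  obtain ⟨i, hi, hmin⟩ : ∃ i, x.1 i = 0 ∧ ∀ j, x.1 j = 0 → i ≤ j := by
    have hne : (Finset.univ.filter fun j => x.1 j = 0).Nonempty := ⟨j₀, by simpa using h₀⟩
    refine ⟨_, (Finset.mem_filter.1 (Finset.min'_mem _ hne)).2, fun j hj => ?_⟩
    exact Finset.min'_le _ _ (by simpa using hj)
  by_cases hl : i.1 < m + 1
  · obtain ⟨j, h1, h2, h3⟩ := hcon ⟨i.1, hl⟩
    have hij : i < j := lt_of_le_of_ne (hmin j h3) fun h => h1 (by ext; simp [h])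
    exact h2 (by ext; simpa using adj i j hij hi h3)
  · obtain ⟨j, h1, h2, h3⟩ := hcon (Fin.last m)
    have := Fin.le_def.1 (hmin j h3)
    exact h2 (by ext; simp; omega)

instance : ChartedSpace (ℂ × ℂ) P.Model where
  atlas := Set.range P.vertexChart
  chartAt p := P.vertexChart (Classical.choose (P.exists_vertexSource p))
  mem_chart_source p := Classical.choose_spec (P.exists_vertexSource p)
  chart_mem_atlas _ := ⟨_, rfl⟩

instance : IsManifold 𝓘(ℝ, ℂ × ℂ) ∞ P.Model := by
  refine isManifold_of_contDiffOn _ _ _ ?_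
  rintro _ _ ⟨k, rfl⟩ ⟨l, rfl⟩
  have key : ContDiffOn ℝ ∞ (fun z => P.coords l.castSucc l.succ (P.vertexSection k z))
      (P.vertexTarget k ∩ P.vertexInv k ⁻¹' P.vertexSource l) := by
    refine (P.contDiffOn_coords _ _).comp
      ((P.contDiffOn_vertexSection k).mono Set.inter_subset_left) ?_
    rintro z ⟨hz, hz'⟩
    rw [Set.mem_preimage, P.vertexInv_of_mem hz, quot_mem_vertexSource] at hz'
    exact hz'
  refine (key.congr ?_).mono (fun z hz => hz.1)
  rintro z ⟨hz, -⟩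
  change P.modelCoords _ _ (P.delzant l) (P.vertexInv k z) = _
  rw [P.vertexInv_of_mem hz]
  rfl

/-! #### The reduced symplectic form -/

/-- The standard symplectic form `∑ⱼ dxⱼ ∧ dyⱼ = (i / 2) ∑ⱼ dzⱼ ∧ dz̄ⱼ` on `ℂⁿ`. -/
def stdForm (n : ℕ) : (Fin n → ℂ) →L[ℝ] (Fin n → ℂ) →L[ℝ] ℝ :=
  ∑ j, ((Complex.reCLM.smulRight Complex.imCLM - Complex.imCLM.smulRight Complex.reCLM :
    ℂ →L[ℝ] ℂ →L[ℝ] ℝ)).bilinearComp (ContinuousLinearMap.proj j) (ContinuousLinearMap.proj j)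

/-- The reduced form on `M_Δ`, that is, the form whose pull-back to `U_Δ` is the restriction of the
standard form. On the domain of a chart, `vertexSection` is a section of `U_Δ → M_Δ`, so that the
reduced form is the pull-back of the standard form under it. -/
def modelForm : BilinField P.Model := fun p =>
  let k := Classical.choose (P.exists_vertexSource p)
  let d : (ℂ × ℂ) →L[ℝ] (Fin (m + 2) → ℂ) :=
    fderiv ℝ (P.vertexSection k) (P.modelCoords k.castSucc k.succ (P.delzant k) p)
  let b : (ℂ × ℂ) →L[ℝ] (ℂ × ℂ) →L[ℝ] ℝ := (stdForm (m + 2)).bilinearComp d d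
  b

/-! ### Corner manifolds with a given moment image -/

section Identification

variable {N : Type*} [TopologicalSpace N] [ChartedSpace (ℂ × ℂ) N] [MulAction (Circle × Circle) N]

/-- An identification of a corner manifold `N` with `M_Δ`: an equivariant symplectomorphism that
intertwines the moment maps. -/
structure Identification (Ω : BilinField N) (Φ : N → ℝ × ℝ) where
  toDiffeo : N ≃ₘ⟮𝓘(ℝ, ℂ × ℂ), 𝓘(ℝ, ℂ × ℂ)⟯ P.Model
  equivariant : ∀ (g : Circle × Circle) (p : N), toDiffeo (g • p) = g • toDiffeo p
  moment : ∀ p, P.modelMoment (toDiffeo p) = Φ p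
  symplectic : ∀ (p : N) (u v : TangentSpace 𝓘(ℝ, ℂ × ℂ) p),
    P.modelForm (toDiffeo p) (mfderiv 𝓘(ℝ, ℂ × ℂ) 𝓘(ℝ, ℂ × ℂ) toDiffeo p u)
      (mfderiv 𝓘(ℝ, ℂ × ℂ) 𝓘(ℝ, ℂ × ℂ) toDiffeo p v) = Ω p u v

/-- The symplectic blowup map `ψ : N ∖ D → ℂ²` of a corner manifold identified with `M_Δ`, as a
total function whose values on `D` are irrelevant. -/
def Identification.blowup {P : CornerPolyhedron m} {Ω : BilinField N} {Φ : N → ℝ × ℝ} (ι : P.Identification Ω Φ) (p : N) :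
    ℂ × ℂ :=
  P.modelBlowup (ι.toDiffeo p)

end Identification

section Chain

variable {N : Type*} (Φ : N → ℝ × ℝ)

/-- The set `S_i = {p | ⟨Φ p, v_i⟩ = a_i}`. -/
def sphere (i : Fin (m + 2)) : Set N := {p | pairing (Φ p) (P.v i) = P.a i}

/-- The chain `D` of isotropy spheres, the union of the `S_i` where `i` is neither the first nor
the last index. -/
def chain : Set N := ⋃ i ∈ {i : Fin (m + 2) | i ≠ 0 ∧ i ≠ Fin.last (m + 1)}, P.sphere Φ i

end Chain

end CornerPolyhedron

/-- The preimage under the moment map of the triangle `w₁ ≥ 0`, `w₂ ≥ 0`, `w₁ + w₂ < ε`. -/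
def triangular {N : Type*} (Φ : N → ℝ × ℝ) (ε : ℝ) : Set N :=
  Φ ⁻¹' {w | 0 ≤ w.1 ∧ 0 ≤ w.2 ∧ w.1 + w.2 < ε}

end

/-!
Up to the level `b'` of the diagonal moment map, `H` is `[x] ↦ [x̄ₙ, …, x̄₁]`, which is
antisymplectic, hence preserves the orientation in real dimension `4`. Away from the spheres it
covers, under the blowup maps, the involution `(z₁, z₂) ↦ (z̄₂, z̄₁)` of `ℂ²`. This is the case
`c = -1` of the map that fixes `z₁ + z̄₂` and multiplies `z₁ - z̄₂` by `c ∈ S¹`; all these maps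
preserve `|z₁|² + |z₂|²` and commute with the anti-diagonal circle. Above the level `b < b'`, which
bounds the middle edges of `Δ`, `c` may be taken to be a smooth function of `(|z₁|² + |z₂|²) / 2`
that moves from `-1` to `1` before the level `β`. The resulting map of `ℂ²` still preserves volume,
and from `β` on it is the identity.
-/

open Complex (orientation)
open scoped ComplexConjugate

noncomputable section

attribute [local instance] Complex.finrank_real_complex_fact

/-! ### The plane twists of `ℂ²` -/

section PlaneTwist

/-- Half of the square of an alternating bilinear form `B`, that is, the `4`-form `(B ∧ B) / 2`. -/
def halfWedgeSq {E : Type*} (B : E → E → ℝ) (u₁ u₂ u₃ u₄ : E) : ℝ :=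
  B u₁ u₂ * B u₃ u₄ - B u₁ u₃ * B u₂ u₄ + B u₁ u₄ * B u₂ u₃

/-- The standard symplectic form on `ℂ²`. -/
def planeForm (u v : ℂ × ℂ) : ℝ := orientation.areaForm u.1 v.1 + orientation.areaForm u.2 v.2

/-- The moment map `(|z₁|² + |z₂|²) / 2` of the diagonal circle action on `ℂ²`. -/
def halfNormSq (z : ℂ × ℂ) : ℝ := 1 / 2 * (‖z.1‖ ^ 2 + ‖z.2‖ ^ 2)

lemma contDiff_halfNormSq : ContDiff ℝ ∞ halfNormSq :=
  contDiff_const.mul ((contDiff_fst.norm_sq ℝ).add (contDiff_snd.norm_sq ℝ))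

lemma areaForm_circle_smul (g : Circle) (u v : ℂ) :
    orientation.areaForm (g * u) (g * v) = orientation.areaForm u v := by
  have hg : (conj (g : ℂ) * g) = 1 := by simp [← Circle.coe_inv_eq_conj]
  rw [Complex.areaForm, Complex.areaForm, map_mul,
    show conj (g : ℂ) * conj u * (g * v) = conj (g : ℂ) * g * (conj u * v) by ring, hg, one_mul]

lemma areaForm_conj (u v : ℂ) :
    orientation.areaForm (conj u) (conj v) = -orientation.areaForm u v := by
  simp [Complex.areaForm]
  ring

lemma areaForm_add_mul_I (z u v : ℂ) (s t : ℝ) :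
    orientation.areaForm (u + z * (Complex.I * s)) (v + z * (Complex.I * t))
      = orientation.areaForm u v + (inner ℝ z u * t - inner ℝ z v * s) := by
  simp [Complex.areaForm, Complex.inner]
  ring

/-- The map `(p, q) ↦ (p, e^{iθ} q)`, where the angle `θ` depends on `(|p|² + |q|²) / 2`. -/
def phaseShear (θ : ℝ → ℝ) (w : ℂ × ℂ) : ℂ × ℂ := (w.1, Circle.exp (θ (halfNormSq w)) * w.2)

lemma halfNormSq_phaseShear (θ : ℝ → ℝ) (w : ℂ × ℂ) :
    halfNormSq (phaseShear θ w) = halfNormSq w := by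
  simp [halfNormSq, phaseShear]

lemma phaseShear_neg_phaseShear (θ : ℝ → ℝ) (w : ℂ × ℂ) :
    phaseShear (fun s => -θ s) (phaseShear θ w) = w := by
  refine Prod.ext rfl ?_
  rw [phaseShear, halfNormSq_phaseShear, phaseShear]
  simp [Circle.exp_neg]

lemma hasDerivAt_circle_exp {θ : ℝ → ℝ} {θ' t : ℝ} (h : HasDerivAt θ θ' t) :
    HasDerivAt (fun t => (Circle.exp (θ t) : ℂ)) (Circle.exp (θ t) * (Complex.I * θ')) t := by
  simp only [Circle.coe_exp]
  exact ((h.ofReal_comp.mul_const Complex.I).cexp).congr_deriv (by ring)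

lemma contDiff_phaseShear {θ : ℝ → ℝ} (hθ : ContDiff ℝ ∞ θ) : ContDiff ℝ ∞ (phaseShear θ) := by
  have hangle : ContDiff ℝ ∞ fun w => (θ (halfNormSq w) : ℂ) :=
    Complex.ofRealCLM.contDiff.comp (hθ.comp contDiff_halfNormSq)
  change ContDiff ℝ ∞ fun w => (w.1, (Circle.exp (θ (halfNormSq w)) : ℂ) * w.2)
  simp only [Circle.coe_exp]
  exact contDiff_fst.prodMk (((hangle.mul contDiff_const).cexp).mul contDiff_snd)

lemma hasDerivAt_halfNormSq_line (w u : ℂ × ℂ) :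
    HasDerivAt (fun t : ℝ => halfNormSq (w + t • u)) (inner ℝ w.1 u.1 + inner ℝ w.2 u.2) 0 := by
  have hline : ∀ z v : ℂ, HasDerivAt (fun t : ℝ => ‖z + t • v‖ ^ 2) (2 * inner ℝ z v) 0 :=
    fun z v => by
      simpa using (((hasDerivAt_id (0 : ℝ)).smul_const v).const_add z).norm_sq
  exact (((hline w.1 u.1).add (hline w.2 u.2)).const_mul (1 / 2)).congr_deriv (by ring)

lemma fderiv_phaseShear {θ : ℝ → ℝ} (hθ : ContDiff ℝ ∞ θ) (w u : ℂ × ℂ) :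
    fderiv ℝ (phaseShear θ) w u =
      (u.1, Circle.exp (θ (halfNormSq w)) * (u.2 + w.2 * (Complex.I *
        (deriv θ (halfNormSq w) * (inner ℝ w.1 u.1 + inner ℝ w.2 u.2) : ℝ)))) := by
  have hline : HasDerivAt (fun t : ℝ => w + t • u) u 0 := by
    simpa using ((hasDerivAt_id (0 : ℝ)).smul_const u).const_add w
  have hw : w + (0 : ℝ) • u = w := by simp
  have hshear : HasFDerivAt (phaseShear θ) (fderiv ℝ (phaseShear θ) w) (w + (0 : ℝ) • u) := by
    rw [hw]
    exact ((contDiff_phaseShear hθ).differentiable (by simp) w).hasFDerivAt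
  have hfst : HasDerivAt (fun t : ℝ => (w + t • u).1) u.1 0 :=
    (ContinuousLinearMap.fst ℝ ℂ ℂ).hasFDerivAt.comp_hasDerivAt (0 : ℝ) hline
  have hsnd : HasDerivAt (fun t : ℝ => (w + t • u).2) u.2 0 :=
    (ContinuousLinearMap.snd ℝ ℂ ℂ).hasFDerivAt.comp_hasDerivAt (0 : ℝ) hline
  have hangle : HasDerivAt (fun t : ℝ => θ (halfNormSq (w + t • u))) _ 0 :=
    (hθ.differentiable (by simp) (halfNormSq (w + (0 : ℝ) • u))).hasDerivAt.comp 0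
      (hasDerivAt_halfNormSq_line w u)
  refine ((hshear.comp_hasDerivAt (0 : ℝ) hline).unique
    (hfst.prodMk ((hasDerivAt_circle_exp hangle).mul hsnd))).trans ?_
  rw [hw]
  refine Prod.ext rfl ?_
  push_cast
  ring

/-- The shear changes the symplectic form by a multiple of `d|p|² ∧ d|q|²`, whose wedge product
with the symplectic form vanishes. -/
lemma halfWedgeSq_fderiv_phaseShear {θ : ℝ → ℝ} (hθ : ContDiff ℝ ∞ θ) (w u₁ u₂ u₃ u₄ : ℂ × ℂ) :
    halfWedgeSq (fun u v => planeForm (fderiv ℝ (phaseShear θ) w u) (fderiv ℝ (phaseShear θ) w v))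
      u₁ u₂ u₃ u₄ = halfWedgeSq planeForm u₁ u₂ u₃ u₄ := by
  have hform : ∀ u v : ℂ × ℂ,
      planeForm (fderiv ℝ (phaseShear θ) w u) (fderiv ℝ (phaseShear θ) w v) =
        planeForm u v + deriv θ (halfNormSq w) *
          (inner ℝ w.2 u.2 * inner ℝ w.1 v.1 - inner ℝ w.2 v.2 * inner ℝ w.1 u.1) := fun u v => by
    rw [fderiv_phaseShear hθ, fderiv_phaseShear hθ, planeForm, areaForm_circle_smul,
      areaForm_add_mul_I, planeForm]
    ring
  simp only [halfWedgeSq, hform]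
  simp [planeForm, Complex.areaForm, Complex.inner]
  ring

/-- The linear coordinates `(z₁ + z̄₂, z₁ - z̄₂)` on `ℂ²`. -/
def sumDiff : (ℂ × ℂ) ≃L[ℝ] ℂ × ℂ :=
  let p := ContinuousLinearMap.fst ℝ ℂ ℂ
  let q := ContinuousLinearMap.snd ℝ ℂ ℂ
  let q' := Complex.conjCLE.toContinuousLinearMap ∘L q
  ContinuousLinearEquiv.equivOfInverse ((p + q').prod (p - q'))
    ((1 / 2 : ℝ) • (p + q).prod (Complex.conjCLE.toContinuousLinearMap ∘L (p - q)))
    (fun z => Prod.ext (by simp [p, q, q']; ring) (by simp [p, q, q']; ring))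
    (fun z => Prod.ext (by simp [p, q, q', Complex.conj_ofNat]; ring)
      (by simp [p, q, q', Complex.conj_ofNat]; ring))

lemma sumDiff_apply (z : ℂ × ℂ) : sumDiff z = (z.1 + conj z.2, z.1 - conj z.2) := rfl

lemma halfNormSq_sumDiff (z : ℂ × ℂ) : halfNormSq (sumDiff z) = 2 * halfNormSq z := by
  have hparallelogram := parallelogram_law_with_norm ℝ z.1 (conj z.2)
  rw [Complex.norm_conj] at hparallelogram
  simp only [halfNormSq, sumDiff_apply]
  linear_combination (1 / 2 : ℝ) * hparallelogram

lemma halfWedgeSq_sumDiff (u₁ u₂ u₃ u₄ : ℂ × ℂ) :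
    halfWedgeSq planeForm (sumDiff u₁) (sumDiff u₂) (sumDiff u₃) (sumDiff u₄) =
      -4 * halfWedgeSq planeForm u₁ u₂ u₃ u₄ := by
  have hform : ∀ u v : ℂ × ℂ, planeForm (sumDiff u) (sumDiff v) =
      2 * (orientation.areaForm u.1 v.1 - orientation.areaForm u.2 v.2) := fun u v => by
    simp [planeForm, sumDiff_apply, Complex.areaForm]
    ring
  simp only [halfWedgeSq, hform]
  simp [planeForm, Complex.areaForm]
  ring

/-- The map of `ℂ²` that fixes `z₁ + z̄₂` and rotates `z₁ - z̄₂` by the angle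
`θ ((|z₁|² + |z₂|²) / 2)`. -/
def planeTwist (θ : ℝ → ℝ) (z : ℂ × ℂ) : ℂ × ℂ :=
  sumDiff.symm (phaseShear (fun s => θ (s / 2)) (sumDiff z))

variable {θ : ℝ → ℝ} {z : ℂ × ℂ}

lemma sumDiff_planeTwist : sumDiff (planeTwist θ z) =
    (z.1 + conj z.2, Circle.exp (θ (halfNormSq z)) * (z.1 - conj z.2)) := by
  rw [planeTwist, sumDiff.apply_symm_apply, phaseShear, halfNormSq_sumDiff,
    mul_div_cancel_left₀ _ two_ne_zero, sumDiff_apply]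

lemma halfNormSq_planeTwist : halfNormSq (planeTwist θ z) = halfNormSq z := by
  have h := halfNormSq_phaseShear (fun s => θ (s / 2)) (sumDiff z)
  rw [halfNormSq_sumDiff, ← sumDiff.apply_symm_apply (phaseShear _ _), halfNormSq_sumDiff] at h
  exact mul_left_cancel₀ two_ne_zero h

lemma planeTwist_neg_planeTwist : planeTwist (fun s => -θ s) (planeTwist θ z) = z := by
  rw [planeTwist, planeTwist, sumDiff.apply_symm_apply,
    phaseShear_neg_phaseShear (fun s => θ (s / 2)), sumDiff.symm_apply_apply]

lemma planeTwist_of_exp_eq_one (h : Circle.exp (θ (halfNormSq z)) = 1) : planeTwist θ z = z := by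
  apply sumDiff.injective
  rw [sumDiff_planeTwist, h, Circle.coe_one, one_mul, sumDiff_apply]

lemma planeTwist_of_exp_eq_neg_one (h : Circle.exp (θ (halfNormSq z)) = -1) :
    planeTwist θ z = (conj z.2, conj z.1) := by
  apply sumDiff.injective
  rw [sumDiff_planeTwist, h, sumDiff_apply, Complex.conj_conj]
  exact Prod.ext (add_comm _ _) (by simp)

lemma planeTwist_antidiagonal (g : Circle) :
    planeTwist θ (g * z.1, (g⁻¹ : Circle) * z.2) =
      (g * (planeTwist θ z).1, (g⁻¹ : Circle) * (planeTwist θ z).2) := by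
  have hsumDiff : ∀ y : ℂ × ℂ, sumDiff (g * y.1, (g⁻¹ : Circle) * y.2) =
      (g * (sumDiff y).1, g * (sumDiff y).2) := fun y => by
    simp only [sumDiff_apply, map_mul, Circle.coe_inv_eq_conj, Complex.conj_conj, mul_add, mul_sub]
  have hnorm : halfNormSq (g * z.1, (g⁻¹ : Circle) * z.2) = halfNormSq z := by
    simp only [halfNormSq, norm_mul, Circle.norm_coe, one_mul]
  apply sumDiff.injective
  rw [hsumDiff, sumDiff_planeTwist, sumDiff_planeTwist, hnorm]
  simp only [map_mul, Circle.coe_inv_eq_conj, Complex.conj_conj]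
  exact Prod.ext (by simp only; ring) (by simp only; ring)

lemma contDiff_planeTwist (hθ : ContDiff ℝ ∞ θ) : ContDiff ℝ ∞ (planeTwist θ) :=
  sumDiff.symm.contDiff.comp
    ((contDiff_phaseShear (hθ.comp (contDiff_id.div_const 2))).comp sumDiff.contDiff)

lemma halfWedgeSq_fderiv_planeTwist (hθ : ContDiff ℝ ∞ θ) (u₁ u₂ u₃ u₄ : ℂ × ℂ) :
    halfWedgeSq (fun u v => planeForm (fderiv ℝ (planeTwist θ) z u) (fderiv ℝ (planeTwist θ) z v))
      u₁ u₂ u₃ u₄ = halfWedgeSq planeForm u₁ u₂ u₃ u₄ := by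
  have hhalf : ContDiff ℝ ∞ fun s => θ (s / 2) := hθ.comp (contDiff_id.div_const 2)
  have hsumDiff : ∀ u, sumDiff (fderiv ℝ (planeTwist θ) z u) =
      fderiv ℝ (phaseShear fun s => θ (s / 2)) (sumDiff z) (sumDiff u) := fun u => by
    have hshear := ((contDiff_phaseShear hhalf).differentiable (by simp)
      (sumDiff z)).hasFDerivAt
    have htwist := sumDiff.symm.hasFDerivAt.comp z (hshear.comp z sumDiff.hasFDerivAt)
    have heq : fderiv ℝ (planeTwist θ) z = _ := htwist.fderiv
    simp [heq]
  have hshear := halfWedgeSq_fderiv_phaseShear hhalf (sumDiff z) (sumDiff u₁) (sumDiff u₂)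
    (sumDiff u₃) (sumDiff u₄)
  rw [halfWedgeSq] at hshear
  simp only [← hsumDiff] at hshear
  have htwist := halfWedgeSq_sumDiff (fderiv ℝ (planeTwist θ) z u₁) (fderiv ℝ (planeTwist θ) z u₂)
    (fderiv ℝ (planeTwist θ) z u₃) (fderiv ℝ (planeTwist θ) z u₄)
  exact mul_left_cancel₀ (by norm_num)
    (htwist.symm.trans (hshear.trans (halfWedgeSq_sumDiff u₁ u₂ u₃ u₄)))

end PlaneTwist

namespace CornerPolyhedron

variable {m : ℕ} {P Q : CornerPolyhedron m}

/-- The level set `U_Δ` as a subset of `ℂⁿ`. -/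
def levelSet (P : CornerPolyhedron m) : Set (Fin (m + 2) → ℂ) :=
  {x | ∀ i, (1 / 2 : ℝ) * ((P.v i).1 * ‖x 0‖ ^ 2 - ‖x i‖ ^ 2 +
    (P.v i).2 * ‖x (Fin.last (m + 1))‖ ^ 2) = P.a i}

/-! ### Conjugate reversal -/

/-- `Q` is the reflection of `P` across the diagonal. Unlike `Q = P.mirror`, this relation is
visibly symmetric. -/
structure IsMirror (P Q : CornerPolyhedron m) : Prop where
  v : ∀ i, Q.v i = (P.v i.rev).swap
  a : ∀ i, Q.a i = P.a i.rev

lemma isMirror_mirror (P : CornerPolyhedron m) : P.IsMirror P.mirror := ⟨fun _ => rfl, fun _ => rfl⟩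

lemma IsMirror.symm (h : P.IsMirror Q) : Q.IsMirror P :=
  ⟨fun i => by rw [h.v, Fin.rev_rev, Prod.swap_swap], fun i => by rw [h.a, Fin.rev_rev]⟩

lemma IsMirror.pairing_sub (h : P.IsMirror Q) (w : ℝ × ℝ) (j : Fin (m + 2)) :
    pairing w (Q.v j) - Q.a j = pairing w.swap (P.v j.rev) - P.a j.rev := by
  rw [h.v, h.a]
  simp only [pairing, Prod.fst_swap, Prod.snd_swap]
  ring

/-- The indices other than the first and the last. -/
abbrev middle (m : ℕ) : Finset (Fin (m + 2)) := {0, Fin.last (m + 1)}ᶜ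

lemma mem_middle {j : Fin (m + 2)} : j ∈ middle m ↔ j ≠ 0 ∧ j ≠ Fin.last (m + 1) := mem_compl_pair

lemma last_ne_zero : Fin.last (m + 1) ≠ 0 := Fin.last_pos.ne'

lemma rev_mem_middle {j : Fin (m + 2)} : j.rev ∈ middle m ↔ j ∈ middle m := by
  rw [mem_middle, mem_middle, Ne, Ne, Fin.rev_eq_iff, Fin.rev_eq_iff, Fin.rev_last, Fin.rev_zero,
    and_comm]

lemma prod_middle_rev {M : Type*} [CommMonoid M] (f : Fin (m + 2) → M) :
    ∏ j ∈ middle m, f j.rev = ∏ j ∈ middle m, f j :=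
  Finset.prod_bij' (fun j _ => j.rev) (fun j _ => j.rev) (fun _ h => rev_mem_middle.2 h)
    (fun _ h => rev_mem_middle.2 h) (fun _ _ => Fin.rev_rev _) (fun _ _ => Fin.rev_rev _)
    (fun _ _ => rfl)

/-- The lift to `ℂⁿ` of the antisymplectic involution that exchanges mirrors:
`(x₁, …, xₙ) ↦ (x̄ₙ, …, x̄₁)`. -/
def conjRev (x : Fin (m + 2) → ℂ) (j : Fin (m + 2)) : ℂ := conj (x j.rev)

lemma conjRev_conjRev (x : Fin (m + 2) → ℂ) : conjRev (conjRev x) = x :=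
  funext fun j => by rw [conjRev, conjRev, Complex.conj_conj, Fin.rev_rev]

lemma contDiff_conjRev : ContDiff ℝ ∞ (conjRev (m := m)) :=
  contDiff_pi.2 fun j => Complex.conjCLE.contDiff.comp (contDiff_apply ℝ ℂ j.rev)

lemma det₂_first_last (P : CornerPolyhedron m) : det₂ (P.v 0) (P.v (Fin.last (m + 1))) = 1 := by
  rw [P.v_first, P.v_last, det₂]
  norm_num

lemma coords_first_last (P : CornerPolyhedron m) (x : Fin (m + 2) → ℂ) :
    P.coords 0 (Fin.last (m + 1)) x =
      (x 0 * ∏ j ∈ middle m, (x j / ‖x j‖) ^ (P.v j).1,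
       x (Fin.last (m + 1)) * ∏ j ∈ middle m, (x j / ‖x j‖) ^ (P.v j).2) := by
  simp [coords, P.v_first, P.v_last, det₂]

lemma coords_conjRev (hPQ : P.IsMirror Q) (x : Fin (m + 2) → ℂ) :
    Q.coords 0 (Fin.last (m + 1)) (conjRev x) =
      (conj (P.coords 0 (Fin.last (m + 1)) x).2, conj (P.coords 0 (Fin.last (m + 1)) x).1) := by
  have hprod : ∀ c : Fin (m + 2) → ℤ,
      ∏ j ∈ middle m, (conjRev x j / ‖conjRev x j‖) ^ c j.rev =
        conj (∏ j ∈ middle m, (x j / ‖x j‖) ^ c j) := fun c => by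
    rw [map_prod, ← prod_middle_rev]
    refine Finset.prod_congr rfl fun j _ => ?_
    rw [conjRev, Complex.norm_conj, map_zpow₀, map_div₀, Complex.conj_ofReal, Fin.rev_rev]
  simp only [coords_first_last, hPQ.v, Prod.fst_swap, Prod.snd_swap, map_mul]
  rw [hprod fun j => (P.v j).1, hprod fun j => (P.v j).2, conjRev, conjRev, Fin.rev_zero,
    Fin.rev_last]

lemma conjRev_mem (hPQ : P.IsMirror Q) (x : P.Level) : conjRev x.1 ∈ Q.levelSet := fun i => by
  simp only [conjRev, Complex.norm_conj, Fin.rev_zero, Fin.rev_last, hPQ.v, hPQ.a, Prod.fst_swap,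
    Prod.snd_swap]
  linear_combination x.2 i.rev

lemma conjRev_smul (k : Fin (m + 2) → Circle) (x : P.Level) :
    conjRev (k • x).1 = fun j => ((k j.rev)⁻¹ : Circle) * conjRev x.1 j :=
  funext fun j => by rw [conjRev, level_smul_apply, map_mul, Circle.coe_inv_eq_conj, conjRev]

lemma inv_rev_mem_K (hPQ : P.IsMirror Q) {k : Fin (m + 2) → Circle} (hk : k ∈ P.K) :
    (fun j => (k j.rev)⁻¹) ∈ Q.K := by
  have hprod : ∀ c : Fin (m + 2) → ℤ,
      ∏ j : Fin (m + 2), (k j.rev)⁻¹ ^ c j.rev = (∏ j, k j ^ c j)⁻¹ := fun c => by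
    rw [← Finset.prod_inv_distrib, ← Equiv.prod_comp Fin.revPerm]
    simp only [Fin.revPerm_apply, Fin.rev_rev, inv_zpow]
  constructor
  · simp only [hPQ.v, Prod.fst_swap]
    rw [hprod fun j => (P.v j).2, hk.2, inv_one]
  · simp only [hPQ.v, Prod.snd_swap]
    rw [hprod fun j => (P.v j).1, hk.1, inv_one]

/-! ### The inverse of the blowup map -/

/-- The moment map of the standard action of the torus on `ℂ²`. -/
def planeMoment (z : ℂ × ℂ) : ℝ × ℝ := ((1 / 2 : ℝ) * ‖z.1‖ ^ 2, (1 / 2 : ℝ) * ‖z.2‖ ^ 2)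

lemma planeMoment_mul (g : Circle × Circle) (z : ℂ × ℂ) :
    planeMoment (g.1 * z.1, g.2 * z.2) = planeMoment z := by
  simp only [planeMoment, norm_mul, Circle.norm_coe, one_mul]

/-- The image under the blowup map of the points outside the chain of spheres. -/
def blowupTarget (P : CornerPolyhedron m) : Set (ℂ × ℂ) :=
  {z | ∀ j ∈ middle m, P.a j < pairing (planeMoment z) (P.v j)}

/-- The point of `U_Δ` over `z` under the blowup map whose middle coordinates are positive real
numbers. -/
def blowupSection (P : CornerPolyhedron m) (z : ℂ × ℂ) (j : Fin (m + 2)) : ℂ :=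
  if j = 0 then z.1 else if j = Fin.last (m + 1) then z.2 else
    (Real.sqrt (2 * (pairing (planeMoment z) (P.v j) - P.a j)) : ℂ)

variable {z : ℂ × ℂ}

lemma blowupSection_zero (P : CornerPolyhedron m) (z : ℂ × ℂ) : P.blowupSection z 0 = z.1 :=
  if_pos rfl

lemma blowupSection_last (P : CornerPolyhedron m) (z : ℂ × ℂ) :
    P.blowupSection z (Fin.last (m + 1)) = z.2 := by
  rw [blowupSection, if_neg last_ne_zero, if_pos rfl]

lemma blowupSection_middle (P : CornerPolyhedron m) (z : ℂ × ℂ) {j : Fin (m + 2)}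
    (hj : j ∈ middle m) :
    P.blowupSection z j =
      Real.sqrt (2 * (pairing (planeMoment z) (P.v j) - P.a j)) := by
  rw [blowupSection, if_neg (mem_middle.1 hj).1, if_neg (mem_middle.1 hj).2]

lemma sqrt_pos_of_mem_blowupTarget (hz : z ∈ P.blowupTarget) {j : Fin (m + 2)}
    (hj : j ∈ middle m) :
    0 < Real.sqrt (2 * (pairing (planeMoment z) (P.v j) - P.a j)) :=
  Real.sqrt_pos.2 (by linarith [hz j hj])

lemma blowupSection_mem_nonvanishing (hz : z ∈ P.blowupTarget) :
    P.blowupSection z ∈ nonvanishing 0 (Fin.last (m + 1)) := fun j h0 h1 => by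
  have hj := mem_middle.2 ⟨h0, h1⟩
  rw [P.blowupSection_middle z hj]
  exact_mod_cast (sqrt_pos_of_mem_blowupTarget hz hj).ne'

lemma half_norm_blowupSection (hz : z ∈ P.blowupTarget) (j : Fin (m + 2)) :
    (1 / 2 : ℝ) * ‖P.blowupSection z j‖ ^ 2 =
      pairing (planeMoment z) (P.v j) - P.a j := by
  by_cases h0 : j = 0
  · subst h0
    simp [blowupSection_zero, P.v_first, P.a_first, pairing, planeMoment]
  by_cases h1 : j = Fin.last (m + 1)
  · subst h1
    simp [blowupSection_last, P.v_last, P.a_last, pairing, planeMoment]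
  have hj := mem_middle.2 ⟨h0, h1⟩
  rw [P.blowupSection_middle z hj, Complex.norm_real, Real.norm_eq_abs, sq_abs,
    Real.sq_sqrt (by linarith [hz j hj])]
  ring

lemma blowupSection_mem (hz : z ∈ P.blowupTarget) : P.blowupSection z ∈ P.levelSet := fun i => by
  have h := half_norm_blowupSection hz i
  rw [pairing, planeMoment] at h
  rw [blowupSection_zero, blowupSection_last]
  linear_combination -h

lemma coords_blowupSection (hz : z ∈ P.blowupTarget) :
    P.coords 0 (Fin.last (m + 1)) (P.blowupSection z) = z := by
  have hphase : ∀ j ∈ middle m, P.blowupSection z j / ‖P.blowupSection z j‖ = 1 := fun j hj => by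
    have hpos := sqrt_pos_of_mem_blowupTarget hz hj
    rw [P.blowupSection_middle z hj, Complex.norm_of_nonneg hpos.le,
      div_self (by exact_mod_cast hpos.ne')]
  have hprod : ∀ c : Fin (m + 2) → ℤ,
      ∏ j ∈ middle m, (P.blowupSection z j / ‖P.blowupSection z j‖) ^ c j = 1 := fun c =>
    Finset.prod_eq_one fun j hj => by rw [hphase j hj, one_zpow]
  rw [coords_first_last, hprod fun j => (P.v j).1, hprod fun j => (P.v j).2, mul_one, mul_one,
    blowupSection_zero, blowupSection_last]

lemma blowupSection_mul (g : Circle × Circle) (z : ℂ × ℂ) (j : Fin (m + 2)) :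
    P.blowupSection (g.1 * z.1, g.2 * z.2) j = ends g j * P.blowupSection z j := by
  unfold blowupSection ends
  rw [planeMoment_mul]
  split_ifs
  exacts [rfl, rfl, by rw [Circle.coe_one, one_mul]]

lemma contDiffAt_blowupSection (hz : z ∈ P.blowupTarget) :
    ContDiffAt ℝ ∞ P.blowupSection z := by
  refine contDiffAt_pi.2 fun j => ?_
  by_cases h0 : j = 0
  · subst h0
    simpa only [blowupSection_zero] using contDiffAt_fst
  by_cases h1 : j = Fin.last (m + 1)
  · subst h1
    simpa only [blowupSection_last] using contDiffAt_snd
  have hj := mem_middle.2 ⟨h0, h1⟩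
  simp only [P.blowupSection_middle _ hj]
  have hfst : ContDiff ℝ ∞ fun z : ℂ × ℂ => ‖z.1‖ ^ 2 := contDiff_fst.norm_sq ℝ
  have hsnd : ContDiff ℝ ∞ fun z : ℂ × ℂ => ‖z.2‖ ^ 2 := contDiff_snd.norm_sq ℝ
  have hradicand : ContDiff ℝ ∞ fun z : ℂ × ℂ => 2 * (pairing (planeMoment z) (P.v j) - P.a j) := by
    simp only [pairing, planeMoment]
    fun_prop
  exact Complex.ofRealCLM.contDiff.contDiffAt.comp z
    (hradicand.contDiffAt.sqrt (Real.sqrt_ne_zero'.1 (sqrt_pos_of_mem_blowupTarget hz hj).ne').ne')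

lemma coords_first_last_eq {x : Fin (m + 2) → ℂ} (hx : x ∈ nonvanishing 0 (Fin.last (m + 1))) :
    P.coords 0 (Fin.last (m + 1)) x =
      (x 0 * (∏ j ∈ middle m, phase (x j) ^ (P.v j).1 : Circle),
       x (Fin.last (m + 1)) * (∏ j ∈ middle m, phase (x j) ^ (P.v j).2 : Circle)) := by
  have hmiddle : ∀ j ∈ middle m, x j ≠ 0 := fun j hj => hx j (mem_middle.1 hj).1 (mem_middle.1 hj).2
  rw [coords_first_last, coe_prod_phase hmiddle, coe_prod_phase hmiddle]

lemma planeMoment_coords {x : Fin (m + 2) → ℂ} (hx : x ∈ nonvanishing 0 (Fin.last (m + 1))) :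
    planeMoment (P.coords 0 (Fin.last (m + 1)) x) = planeMoment (x 0, x (Fin.last (m + 1))) := by
  simp only [coords_first_last_eq hx, planeMoment, norm_mul, Circle.norm_coe, mul_one]

lemma half_norm_level_eq (x : P.Level) (j : Fin (m + 2)) : (1 / 2 : ℝ) * ‖x.1 j‖ ^ 2 =
    pairing (planeMoment (x.1 0, x.1 (Fin.last (m + 1)))) (P.v j) - P.a j :=
  P.half_norm_level x j

lemma coords_mem_blowupTarget {x : P.Level} (hx : x.1 ∈ nonvanishing 0 (Fin.last (m + 1))) :
    P.coords 0 (Fin.last (m + 1)) x.1 ∈ P.blowupTarget := fun j hj => by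
  have hpos := norm_pos_iff.2 (hx j (mem_middle.1 hj).1 (mem_middle.1 hj).2)
  rw [planeMoment_coords hx, ← sub_pos, ← half_norm_level_eq]
  positivity

lemma quot_blowupSection_coords {x : P.Level} (hx : x.1 ∈ nonvanishing 0 (Fin.last (m + 1))) :
    P.quot ⟨_, blowupSection_mem (coords_mem_blowupTarget hx)⟩ = P.quot x := by
  let prodPhase (c : Fin (m + 2) → ℤ) : Circle := ∏ j ∈ middle m, phase (x.1 j) ^ c j
  let k (j : Fin (m + 2)) : Circle :=
    if j = 0 then prodPhase fun j => (P.v j).1 else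
      if j = Fin.last (m + 1) then prodPhase fun j => (P.v j).2 else (phase (x.1 j))⁻¹
  have hzero : k 0 = prodPhase fun j => (P.v j).1 := if_pos rfl
  have hlast : k (Fin.last (m + 1)) = prodPhase fun j => (P.v j).2 :=
    (if_neg last_ne_zero).trans (if_pos rfl)
  have hmiddle : ∀ j ∈ middle m, k j = (phase (x.1 j))⁻¹ := fun j hj =>
    (if_neg (mem_middle.1 hj).1).trans (if_neg (mem_middle.1 hj).2)
  have hprod : ∀ c : Fin (m + 2) → ℤ, ∏ j ∈ middle m, k j ^ c j = (prodPhase c)⁻¹ := fun c => by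
    rw [← Finset.prod_inv_distrib]
    exact Finset.prod_congr rfl fun j hj => by rw [hmiddle j hj, inv_zpow]
  refine P.quot_eq_iff.2 ⟨k, ⟨?_, ?_⟩, Subtype.ext (funext fun j => ?_)⟩
  · rw [prod_split last_ne_zero.symm, hprod fun j => (P.v j).1, hzero]
    simp [P.v_first, P.v_last]
  · rw [prod_split last_ne_zero.symm, hprod fun j => (P.v j).2, hlast]
    simp [P.v_first, P.v_last]
  change k j * x.1 j = P.blowupSection (P.coords 0 (Fin.last (m + 1)) x.1) j
  by_cases h0 : j = 0
  · subst h0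
    rw [blowupSection_zero, coords_first_last_eq hx, hzero, mul_comm]
  by_cases h1 : j = Fin.last (m + 1)
  · subst h1
    rw [blowupSection_last, coords_first_last_eq hx, hlast, mul_comm]
  have hj := mem_middle.2 ⟨h0, h1⟩
  have hxj := hx j h0 h1
  have hnorm : (‖x.1 j‖ : ℂ) ≠ 0 := by simpa using hxj
  rw [P.blowupSection_middle _ hj, planeMoment_coords hx, ← half_norm_level_eq,
    ← mul_assoc, mul_one_div_cancel two_ne_zero, one_mul, Real.sqrt_sq (norm_nonneg _),
    hmiddle j hj, Circle.coe_inv, coe_phase hxj]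
  field_simp

variable {b b' : ℝ} {θ : ℝ → ℝ}

/-! ### The mirror map -/

/-- The moment map of the diagonal circle action on `ℂⁿ`. -/
def diagMoment (x : Fin (m + 2) → ℂ) : ℝ := halfNormSq (x 0, x (Fin.last (m + 1)))

lemma continuous_diagMoment : Continuous (diagMoment (m := m)) :=
  contDiff_halfNormSq.continuous.comp ((continuous_apply _).prodMk (continuous_apply _))

lemma diagMoment_conjRev (x : Fin (m + 2) → ℂ) : diagMoment (conjRev x) = diagMoment x := by
  simp only [diagMoment, halfNormSq, conjRev, Complex.norm_conj, Fin.rev_zero, Fin.rev_last]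
  ring

lemma diagMoment_blowupSection (z : ℂ × ℂ) : diagMoment (P.blowupSection z) = halfNormSq z := by
  rw [diagMoment, blowupSection_zero, blowupSection_last]

lemma diagMoment_smul (k : Fin (m + 2) → Circle) (x : P.Level) :
    diagMoment (k • x).1 = diagMoment x.1 := by
  simp only [diagMoment, halfNormSq, level_smul_apply, norm_mul, Circle.norm_coe, one_mul]

lemma halfNormSq_eq_planeMoment (z : ℂ × ℂ) :
    halfNormSq z = (planeMoment z).1 + (planeMoment z).2 := by
  rw [halfNormSq, mul_add, planeMoment]

lemma halfNormSq_coords {x : Fin (m + 2) → ℂ} (hx : x ∈ nonvanishing 0 (Fin.last (m + 1))) :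
    halfNormSq (P.coords 0 (Fin.last (m + 1)) x) = diagMoment x := by
  rw [halfNormSq_eq_planeMoment, planeMoment_coords hx, ← halfNormSq_eq_planeMoment, diagMoment]

lemma coords_ends_smul (g : Circle × Circle) (x : P.Level) :
    P.coords 0 (Fin.last (m + 1)) (ends (m := m) g • x).1 =
      (g.1 * (P.coords 0 (Fin.last (m + 1)) x.1).1,
        g.2 * (P.coords 0 (Fin.last (m + 1)) x.1).2) := by
  have hprod : ∀ c : Fin (m + 2) → ℤ,
      ∏ j ∈ middle m, ((ends (m := m) g • x).1 j / ‖(ends (m := m) g • x).1 j‖) ^ c j =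
        ∏ j ∈ middle m, (x.1 j / ‖x.1 j‖) ^ c j := fun c =>
    Finset.prod_congr rfl fun j hj => by
      rw [level_smul_apply, ends, if_neg (mem_middle.1 hj).1, if_neg (mem_middle.1 hj).2,
        Circle.coe_one, one_mul]
  rw [coords_first_last, coords_first_last, hprod fun j => (P.v j).1, hprod fun j => (P.v j).2,
    level_smul_apply, level_smul_apply, mul_assoc, mul_assoc]
  simp [ends]

lemma modelMoment_quot (x : P.Level) :
    P.modelMoment (P.quot x) = planeMoment (x.1 0, x.1 (Fin.last (m + 1))) := rfl

lemma pairing_modelMoment_eq_iff (x : P.Level) (j : Fin (m + 2)) :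
    pairing (P.modelMoment (P.quot x)) (P.v j) = P.a j ↔ x.1 j = 0 := by
  rw [modelMoment_quot, ← sub_eq_zero, ← half_norm_level_eq]
  simp

/-- `θ` is an angle function to twist `ℂ²` by: smooth, and an odd multiple of `π` on `(-∞, b')`.
Here `b < b'` is such that all `z` with `(|z₁|² + |z₂|²) / 2 > b` lie in the image of the blowup
map. -/
structure TwistProfile (P : CornerPolyhedron m) (b b' : ℝ) (θ : ℝ → ℝ) : Prop where
  lt : b < b'
  smooth : ContDiff ℝ ∞ θ
  exp_eq_neg_one : ∀ s < b', Circle.exp (θ s) = -1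
  mem_blowupTarget : ∀ z, b < halfNormSq z → z ∈ P.blowupTarget

lemma TwistProfile.neg (hθ : P.TwistProfile b b' θ) (hPQ : P.IsMirror Q) :
    Q.TwistProfile b b' (fun s => -θ s) where
  lt := hθ.lt
  smooth := hθ.smooth.neg
  exp_eq_neg_one s hs := by rw [Circle.exp_neg, hθ.exp_eq_neg_one s hs, inv_neg, inv_one]
  mem_blowupTarget z hz j hj := by
    have hswap := hθ.mem_blowupTarget z.swap
      (by simpa only [halfNormSq, Prod.fst_swap, Prod.snd_swap, add_comm] using hz)
      j.rev (rev_mem_middle.2 hj)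
    rwa [← sub_pos, ← show (planeMoment z).swap = planeMoment z.swap from rfl, ← hPQ.pairing_sub,
      sub_pos] at hswap

/-- A lift of the mirror map to `ℂⁿ`: the conjugate reversal up to the level `b` of `diagMoment`,
and the twist of `ℂ²`, transported by the blowup maps, above. -/
def mirrorLift (P Q : CornerPolyhedron m) (b : ℝ) (θ : ℝ → ℝ) (x : Fin (m + 2) → ℂ) :
    Fin (m + 2) → ℂ :=
  if diagMoment x ≤ b then conjRev x
  else Q.blowupSection (planeTwist θ (P.coords 0 (Fin.last (m + 1)) x))

lemma mirrorLift_of_le {x : Fin (m + 2) → ℂ} (h : diagMoment x ≤ b) :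
    P.mirrorLift Q b θ x = conjRev x := if_pos h

lemma mirrorLift_of_lt {x : Fin (m + 2) → ℂ} (h : b < diagMoment x) :
    P.mirrorLift Q b θ x = Q.blowupSection (planeTwist θ (P.coords 0 (Fin.last (m + 1)) x)) :=
  if_neg h.not_ge

namespace TwistProfile

section LevelSets

variable (hθ : P.TwistProfile b b' θ)

include hθ

lemma mem_nonvanishing {x : P.Level} (hx : b < diagMoment x.1) :
    x.1 ∈ nonvanishing 0 (Fin.last (m + 1)) := fun j h0 h1 hxj => by
  have hlt := hθ.mem_blowupTarget _ hx j (mem_middle.2 ⟨h0, h1⟩)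
  have hlevel := half_norm_level_eq x j
  rw [hxj, norm_zero] at hlevel
  linarith

variable (hPQ : P.IsMirror Q)

include hPQ

lemma planeTwist_mem_blowupTarget {x : P.Level} (hx : b < diagMoment x.1) :
    planeTwist θ (P.coords 0 (Fin.last (m + 1)) x.1) ∈ Q.blowupTarget :=
  (hθ.neg hPQ).mem_blowupTarget _
    (by rwa [halfNormSq_planeTwist, halfNormSq_coords (hθ.mem_nonvanishing hx)])

lemma mirrorLift_mem (x : P.Level) : P.mirrorLift Q b θ x.1 ∈ Q.levelSet := by
  rcases le_or_gt (diagMoment x.1) b with h | h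
  · rw [mirrorLift_of_le h]
    exact conjRev_mem hPQ x
  · rw [mirrorLift_of_lt h]
    exact blowupSection_mem (hθ.planeTwist_mem_blowupTarget hPQ h)

end LevelSets

variable (hθ : P.TwistProfile b b' θ) (hPQ : P.IsMirror Q)

/-- The mirror map of level sets. -/
def mirrorLevel (x : P.Level) : Q.Level := ⟨P.mirrorLift Q b θ x.1, hθ.mirrorLift_mem hPQ x⟩

lemma quot_mirrorLevel_smul {k : Fin (m + 2) → Circle} (hk : k ∈ P.K) (x : P.Level) :
    Q.quot (hθ.mirrorLevel hPQ (k • x)) = Q.quot (hθ.mirrorLevel hPQ x) := by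
  rcases le_or_gt (diagMoment x.1) b with h | h
  · refine Q.quot_eq_iff.2 ⟨_, inv_rev_mem_K hPQ hk, Subtype.ext ?_⟩
    refine Eq.trans ?_ (mirrorLift_of_le ((diagMoment_smul k x).trans_le h)).symm
    rw [conjRev_smul, ← mirrorLift_of_le h (Q := Q) (θ := θ)]
    rfl
  · refine congrArg Q.quot (Subtype.ext ?_)
    refine (mirrorLift_of_lt (h.trans_eq (diagMoment_smul k x).symm)).trans ?_
    rw [P.coords_smul P.det₂_first_last hk]
    exact (mirrorLift_of_lt h).symm

/-- The mirror map of reduced spaces. -/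
def mirrorMap : P.Model → Q.Model :=
  Quotient.lift (fun x => Q.quot (hθ.mirrorLevel hPQ x)) (by
    rintro _ x ⟨⟨k, hk⟩, rfl⟩
    exact hθ.quot_mirrorLevel_smul hPQ hk x)

/-- Between the levels `b` and `b'`, the conjugate reversal covers the twist of `ℂ²`. -/
lemma mirrorMap_quot_of_lt {x : P.Level} (hx : diagMoment x.1 < b') :
    hθ.mirrorMap hPQ (P.quot x) = Q.quot ⟨conjRev x.1, conjRev_mem hPQ x⟩ := by
  change Q.quot (hθ.mirrorLevel hPQ x) = _
  rcases le_or_gt (diagMoment x.1) b with h | h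
  · exact congrArg Q.quot (Subtype.ext (mirrorLift_of_le h))
  have hrev : conjRev x.1 ∈ nonvanishing 0 (Fin.last (m + 1)) :=
    (hθ.neg hPQ).mem_nonvanishing (x := ⟨conjRev x.1, conjRev_mem hPQ x⟩)
      (h.trans_eq (diagMoment_conjRev _).symm)
  have hcover : planeTwist θ (P.coords 0 (Fin.last (m + 1)) x.1) =
      Q.coords 0 (Fin.last (m + 1)) (conjRev x.1) := by
    rw [coords_conjRev hPQ, planeTwist_of_exp_eq_neg_one (hθ.exp_eq_neg_one _ _)]
    rwa [halfNormSq_coords (hθ.mem_nonvanishing h)]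
  exact (congrArg Q.quot (Subtype.ext ((mirrorLift_of_lt h).trans
    (congrArg Q.blowupSection hcover)))).trans
      (quot_blowupSection_coords (x := ⟨conjRev x.1, conjRev_mem hPQ x⟩) hrev)

lemma mirrorMap_quot_of_gt {x : P.Level} (hx : b < diagMoment x.1) :
    hθ.mirrorMap hPQ (P.quot x) =
      Q.quot ⟨_, blowupSection_mem (hθ.planeTwist_mem_blowupTarget hPQ hx)⟩ :=
  congrArg Q.quot (Subtype.ext (mirrorLift_of_lt hx))

include hθ in
lemma diagMoment_mirrorLift (x : P.Level) :
    diagMoment (P.mirrorLift Q b θ x.1) = diagMoment x.1 := by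
  rcases le_or_gt (diagMoment x.1) b with h | h
  · rw [mirrorLift_of_le h, diagMoment_conjRev]
  · rw [mirrorLift_of_lt h, diagMoment_blowupSection, halfNormSq_planeTwist,
      halfNormSq_coords (hθ.mem_nonvanishing h)]

lemma mirrorMap_mirrorMap (p : P.Model) :
    (hθ.neg hPQ).mirrorMap hPQ.symm (hθ.mirrorMap hPQ p) = p := by
  obtain ⟨x, rfl⟩ := P.quot_surjective p
  rcases le_or_gt (diagMoment x.1) b with h | h
  · have hlt := h.trans_lt hθ.lt
    refine (congrArg _ (hθ.mirrorMap_quot_of_lt hPQ hlt)).trans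
      (((hθ.neg hPQ).mirrorMap_quot_of_lt hPQ.symm (x := ⟨_, conjRev_mem hPQ x⟩)
        ((diagMoment_conjRev x.1).trans_lt hlt)).trans ?_)
    exact congrArg P.quot (Subtype.ext (conjRev_conjRev x.1))
  · have htwist := hθ.planeTwist_mem_blowupTarget hPQ h
    have hdiag : b < diagMoment (Q.blowupSection
        (planeTwist θ (P.coords 0 (Fin.last (m + 1)) x.1))) := by
      rwa [← mirrorLift_of_lt h, hθ.diagMoment_mirrorLift]
    refine (congrArg _ (hθ.mirrorMap_quot_of_gt hPQ h)).trans
      (((hθ.neg hPQ).mirrorMap_quot_of_gt hPQ.symm (x := ⟨_, blowupSection_mem htwist⟩)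
        hdiag).trans ?_)
    rw [← quot_blowupSection_coords (hθ.mem_nonvanishing h)]
    refine congrArg P.quot (Subtype.ext ?_)
    change P.blowupSection _ = _
    rw [coords_blowupSection htwist, planeTwist_neg_planeTwist]

lemma mirrorMap_antidiagonal (g : Circle) (p : P.Model) :
    hθ.mirrorMap hPQ ((g, g⁻¹) • p) = (g, g⁻¹) • hθ.mirrorMap hPQ p := by
  obtain ⟨x, rfl⟩ := P.quot_surjective p
  change hθ.mirrorMap hPQ (P.quot (ends (g, g⁻¹) • x)) =
    Q.quot (ends (g, g⁻¹) • hθ.mirrorLevel hPQ x)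
  refine congrArg Q.quot (Subtype.ext (funext fun j => ?_))
  change P.mirrorLift Q b θ _ j = ends (g, g⁻¹) j * P.mirrorLift Q b θ x.1 j
  rcases le_or_gt (diagMoment x.1) b with h | h
  · have hends : (ends (g, g⁻¹) j.rev)⁻¹ = ends (g, g⁻¹) j := by
      simp only [ends, Fin.rev_eq_iff, Fin.rev_zero, Fin.rev_last]
      split_ifs <;> simp_all
    rw [mirrorLift_of_le h, mirrorLift_of_le ((diagMoment_smul _ x).trans_le h), conjRev_smul]
    exact congrArg (fun c : Circle => (c : ℂ) * conjRev x.1 j) hends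
  · rw [mirrorLift_of_lt h, mirrorLift_of_lt (h.trans_eq (diagMoment_smul _ x).symm),
      coords_ends_smul, planeTwist_antidiagonal]
    exact blowupSection_mul (g, g⁻¹) _ j

lemma modelMoment_mirrorMap (p : P.Model) :
    (Q.modelMoment (hθ.mirrorMap hPQ p)).1 + (Q.modelMoment (hθ.mirrorMap hPQ p)).2 =
      (P.modelMoment p).1 + (P.modelMoment p).2 := by
  obtain ⟨x, rfl⟩ := P.quot_surjective p
  change (Q.modelMoment (Q.quot (hθ.mirrorLevel hPQ x))).1 +
    (Q.modelMoment (Q.quot (hθ.mirrorLevel hPQ x))).2 = _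
  rw [modelMoment_quot, modelMoment_quot, ← halfNormSq_eq_planeMoment, ← halfNormSq_eq_planeMoment]
  exact hθ.diagMoment_mirrorLift x

lemma pairing_modelMoment_mirrorMap (p : P.Model) {j : Fin (m + 2)} (hj : j ∈ middle m) :
    pairing (Q.modelMoment (hθ.mirrorMap hPQ p)) (Q.v j.rev) = Q.a j.rev ↔
      pairing (P.modelMoment p) (P.v j) = P.a j := by
  obtain ⟨x, rfl⟩ := P.quot_surjective p
  rw [pairing_modelMoment_eq_iff]
  refine (pairing_modelMoment_eq_iff (hθ.mirrorLevel hPQ x) j.rev).trans ?_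
  change P.mirrorLift Q b θ x.1 j.rev = 0 ↔ _
  rcases le_or_gt (diagMoment x.1) b with h | h
  · rw [mirrorLift_of_le h, conjRev, Fin.rev_rev, map_eq_zero]
  · obtain ⟨h0, h1⟩ := mem_middle.1 hj
    obtain ⟨h0', h1'⟩ := mem_middle.1 (rev_mem_middle.2 hj)
    rw [mirrorLift_of_lt h]
    exact iff_of_false
      (blowupSection_mem_nonvanishing (hθ.planeTwist_mem_blowupTarget hPQ h) _ h0' h1')
      (hθ.mem_nonvanishing h j h0 h1)

lemma modelBlowup_mirrorMap {p : P.Model} (hp : b < (P.modelMoment p).1 + (P.modelMoment p).2) :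
    Q.modelBlowup (hθ.mirrorMap hPQ p) = planeTwist θ (P.modelBlowup p) := by
  obtain ⟨x, rfl⟩ := P.quot_surjective p
  rw [modelMoment_quot, ← halfNormSq_eq_planeMoment] at hp
  rw [hθ.mirrorMap_quot_of_gt hPQ hp]
  exact coords_blowupSection (hθ.planeTwist_mem_blowupTarget hPQ hp)

end TwistProfile

end CornerPolyhedron

/-! ### The reduced form in coordinates -/

lemma hasDerivAt_normalize {γ : ℝ → ℂ} {γ' : ℂ} {t : ℝ} (h : HasDerivAt γ γ' t) (h0 : γ t ≠ 0) :
    HasDerivAt (fun t => γ t / (‖γ t‖ : ℂ))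
      (γ t / ‖γ t‖ * (Complex.I * (orientation.areaForm (γ t) γ' / ‖γ t‖ ^ 2 : ℝ))) t := by
  have hn : (‖γ t‖ : ℂ) ≠ 0 := by simpa using h0
  have hnorm : HasDerivAt (fun t => ‖γ t‖) (inner ℝ (γ t) γ' / ‖γ t‖) t := by
    have hsqrt := h.norm_sq.sqrt (by simpa using h0)
    simp only [Real.sqrt_sq (norm_nonneg _)] at hsqrt
    exact hsqrt.congr_deriv (mul_div_mul_left _ _ two_ne_zero)
  have hkahler : γ t * (inner ℝ (γ t) γ' + orientation.areaForm (γ t) γ' * Complex.I) =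
      γ' * ‖γ t‖ ^ 2 := by
    have happly := orientation.kahler_apply_apply (γ t) γ'
    rw [Complex.kahler] at happly
    rw [← Complex.mul_conj', ← Complex.real_smul, ← happly]
    ring
  refine (h.div hnorm.ofReal_comp hn).congr_deriv ?_
  push_cast
  field_simp
  linear_combination -hkahler

lemma hasDerivAt_prod_of_rotating {ι : Type*} {s : Finset ι} {γ : ι → ℝ → ℂ} {t : ℝ} {τ : ι → ℝ}
    (h : ∀ j ∈ s, HasDerivAt (γ j) (γ j t * (Complex.I * τ j)) t) :
    HasDerivAt (fun t => ∏ j ∈ s, γ j t)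
      ((∏ j ∈ s, γ j t) * (Complex.I * (∑ j ∈ s, τ j : ℝ))) t := by
  classical
  refine (HasDerivAt.fun_finsetProd h).congr_deriv ?_
  push_cast
  rw [Finset.mul_sum, Finset.mul_sum]
  refine Finset.sum_congr rfl fun j hj => ?_
  rw [smul_eq_mul, ← mul_assoc, Finset.prod_erase_mul s (fun j => γ j t) hj]

/-- The differential of `∑ⱼ cⱼ arg xⱼ`, where `j` runs through `s`. -/
def angular {ι : Type*} (s : Finset ι) (c : ι → ℤ) (x u : ι → ℂ) : ℝ :=
  ∑ j ∈ s, c j * (orientation.areaForm (x j) (u j) / ‖x j‖ ^ 2)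

lemma hasDerivAt_prod_normalize_zpow {ι : Type*} {γ : ℝ → ι → ℂ} {γ' : ι → ℂ} {t : ℝ}
    {s : Finset ι} (h : ∀ j ∈ s, HasDerivAt (fun t => γ t j) (γ' j) t) (h0 : ∀ j ∈ s, γ t j ≠ 0)
    (c : ι → ℤ) :
    HasDerivAt (fun t => ∏ j ∈ s, (γ t j / (‖γ t j‖ : ℂ)) ^ c j)
      ((∏ j ∈ s, (γ t j / ‖γ t j‖) ^ c j) * (Complex.I * (angular s c (γ t) γ' : ℝ))) t := by
  refine hasDerivAt_prod_of_rotating (γ := fun j t => (γ t j / (‖γ t j‖ : ℂ)) ^ c j) fun j hj => ?_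
  have hj0 := h0 j hj
  have hne : γ t j / (‖γ t j‖ : ℂ) ≠ 0 := div_ne_zero hj0 (by simpa using hj0)
  refine ((hasDerivAt_zpow (c j) _ (Or.inl hne)).comp t
    (hasDerivAt_normalize (h j hj) hj0)).congr_deriv ?_
  rw [zpow_sub_one₀ hne]
  push_cast
  field_simp

namespace CornerPolyhedron

variable {m : ℕ} {P : CornerPolyhedron m} {i i' : Fin (m + 2)}

lemma isOpen_nonvanishing (i i' : Fin (m + 2)) : IsOpen (nonvanishing i i') := by
  simp only [nonvanishing, Set.ofPred_forall]
  exact isOpen_iInter_of_finite fun j => isOpen_iInter_of_finite fun _ =>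
    isOpen_iInter_of_finite fun _ => isOpen_ne_fun (continuous_apply j) continuous_const

lemma contDiffAt_coords {x : Fin (m + 2) → ℂ} (hx : x ∈ nonvanishing i i') :
    ContDiffAt ℝ ∞ (P.coords i i') x :=
  (P.contDiffOn_coords i i').contDiffAt ((isOpen_nonvanishing i i').mem_nhds hx)

lemma hasDerivAt_coords {γ : ℝ → Fin (m + 2) → ℂ} {γ' : Fin (m + 2) → ℂ} {t : ℝ}
    (h : HasDerivAt γ γ' t) (hγ : γ t ∈ nonvanishing i i') :
    HasDerivAt (fun t => P.coords i i' (γ t))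
      ((∏ j ∈ {i, i'}ᶜ, phase (γ t j) ^ det₂ (P.v j) (P.v i') : Circle) * (γ' i +
          γ t i * (Complex.I * (angular {i, i'}ᶜ (fun j => det₂ (P.v j) (P.v i')) (γ t) γ' : ℝ))),
        (∏ j ∈ {i, i'}ᶜ, phase (γ t j) ^ det₂ (P.v i) (P.v j) : Circle) * (γ' i' +
          γ t i' * (Complex.I * (angular {i, i'}ᶜ (fun j => det₂ (P.v i) (P.v j)) (γ t) γ' : ℝ))))
      t := by
  have h0 : ∀ j ∈ ({i, i'} : Finset (Fin (m + 2)))ᶜ, γ t j ≠ 0 := fun j hj =>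
    hγ j (mem_compl_pair.1 hj).1 (mem_compl_pair.1 hj).2
  have hcoord := hasDerivAt_pi.1 h
  have hprod := hasDerivAt_prod_normalize_zpow (fun j _ => hcoord j) h0
  refine (((hcoord i).mul (hprod _)).prodMk ((hcoord i').mul (hprod _))).congr_deriv ?_
  rw [coe_prod_phase h0, coe_prod_phase h0]
  refine Prod.ext ?_ ?_ <;> simp only <;> ring

lemma pairing_eq_add (hdet : det₂ (P.v i) (P.v i') = 1) (w : ℝ × ℝ) (j : Fin (m + 2)) :
    pairing w (P.v j) = det₂ (P.v j) (P.v i') * pairing w (P.v i) +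
      det₂ (P.v i) (P.v j) * pairing w (P.v i') := by
  have hdet' : ((P.v i).1 : ℝ) * (P.v i').2 - (P.v i).2 * (P.v i').1 = 1 := by exact_mod_cast hdet
  simp only [pairing, det₂]
  push_cast
  linear_combination (-w.1 * (P.v j).1 - w.2 * (P.v j).2) * hdet'

/-- The tangent space of the level set at `x`, the kernel of the differential of the moment map of
`K`: the differentials of the functions `|xⱼ|² / 2` depend on `j` as the `⟨w, vⱼ⟩` do. -/
def IsTangent (P : CornerPolyhedron m) (x u : Fin (m + 2) → ℂ) : Prop :=
  ∃ w : ℝ × ℝ, ∀ j, inner ℝ (x j) (u j) = pairing w (P.v j)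

lemma isTangent_of_hasDerivAt {γ : ℝ → Fin (m + 2) → ℂ} {γ' : Fin (m + 2) → ℂ} {t : ℝ}
    (h : HasDerivAt γ γ' t) (hγ : ∀ᶠ s in 𝓝 t, γ s ∈ P.levelSet) : P.IsTangent (γ t) γ' := by
  refine ⟨(inner ℝ (γ t 0) (γ' 0), inner ℝ (γ t (Fin.last (m + 1))) (γ' (Fin.last (m + 1)))),
    fun j => ?_⟩
  have hnorm := fun j => (hasDerivAt_pi.1 h j).norm_sq
  have hlevel := ((((hnorm 0).const_mul ((P.v j).1 : ℝ)).sub (hnorm j)).add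
    ((hnorm (Fin.last (m + 1))).const_mul ((P.v j).2 : ℝ))).const_mul (1 / 2)
  have hzero := hlevel.unique ((hasDerivAt_const t (P.a j)).congr_of_eventuallyEq
    (hγ.mono fun s hs => hs j))
  simp only [pairing]
  linear_combination -hzero

lemma stdForm_apply (n : ℕ) (u v : Fin n → ℂ) :
    stdForm n u v = ∑ j, orientation.areaForm (u j) (v j) := by
  simp [stdForm, Complex.areaForm, sub_eq_add_neg, Finset.sum_add_distrib]

/-- In polar coordinates the standard form is `∑ⱼ d(|xⱼ|² / 2) ∧ d(arg xⱼ)`. Tangency expresses the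
`d(|xⱼ|² / 2)` through those with indices `i` and `i'`. -/
lemma sum_areaForm_of_isTangent (hdet : det₂ (P.v i) (P.v i') = 1) {x : Fin (m + 2) → ℂ}
    (hx : x ∈ nonvanishing i i') {u v : Fin (m + 2) → ℂ} (hu : P.IsTangent x u)
    (hv : P.IsTangent x v) :
    ∑ j ∈ {i, i'}ᶜ, orientation.areaForm (u j) (v j) =
      (inner ℝ (x i) (u i) * angular {i, i'}ᶜ (fun j => det₂ (P.v j) (P.v i')) x v
        - inner ℝ (x i) (v i) * angular {i, i'}ᶜ (fun j => det₂ (P.v j) (P.v i')) x u)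
      + (inner ℝ (x i') (u i') * angular {i, i'}ᶜ (fun j => det₂ (P.v i) (P.v j)) x v
        - inner ℝ (x i') (v i') * angular {i, i'}ᶜ (fun j => det₂ (P.v i) (P.v j)) x u) := by
  obtain ⟨wu, hwu⟩ := hu
  obtain ⟨wv, hwv⟩ := hv
  simp only [angular, Finset.mul_sum]
  rw [← Finset.sum_sub_distrib, ← Finset.sum_sub_distrib, ← Finset.sum_add_distrib]
  refine Finset.sum_congr rfl fun j hj => ?_
  have hxj : ‖x j‖ ≠ 0 :=
    norm_ne_zero_iff.2 (hx j (mem_compl_pair.1 hj).1 (mem_compl_pair.1 hj).2)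
  have hpolar := orientation.inner_mul_areaForm_sub (x j) (u j) (v j)
  rw [hwu, hwv, pairing_eq_add hdet wu j, pairing_eq_add hdet wv j, ← hwu, ← hwu, ← hwv,
    ← hwv] at hpolar
  field_simp
  linear_combination -hpolar

variable {E : Type*} [NormedAddCommGroup E] [NormedSpace ℝ E] {f : E → Fin (m + 2) → ℂ} {z : E}

lemma planeForm_fderiv_coords_comp (hdet : det₂ (P.v i) (P.v i') = 1)
    (hf : DifferentiableAt ℝ f z) (hz : f z ∈ nonvanishing i i')
    (hlevel : ∀ᶠ y in 𝓝 z, f y ∈ P.levelSet) (u v : E) :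
    planeForm (fderiv ℝ (fun y => P.coords i i' (f y)) z u)
        (fderiv ℝ (fun y => P.coords i i' (f y)) z v) =
      stdForm (m + 2) (fderiv ℝ f z u) (fderiv ℝ f z v) := by
  have hcoords := ((contDiffAt_coords (P := P) hz).differentiableAt (by simp)).comp z hf
  have hline : ∀ u, HasDerivAt (fun t : ℝ => f (z + t • u)) (fderiv ℝ f z u) 0 :=
    fun u => hf.hasFDerivAt.hasLineDerivAt u
  have hz0 : ∀ u, f (z + (0 : ℝ) • u) = f z := fun u => by rw [zero_smul, add_zero]
  have htangent : ∀ u, P.IsTangent (f z) (fderiv ℝ f z u) := fun u => by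
    have hcont : Filter.Tendsto (fun t : ℝ => z + t • u) (𝓝 0) (𝓝 z) :=
      Continuous.tendsto' (by fun_prop) _ _ (by simp)
    simpa only [hz0] using isTangent_of_hasDerivAt (hline u) (hcont.eventually hlevel)
  have hderiv := fun u => (hcoords.hasFDerivAt.hasLineDerivAt u).unique
    (hasDerivAt_coords (P := P) (hline u) ((hz0 u).symm ▸ hz))
  simp only [hz0] at hderiv
  change planeForm (fderiv ℝ (P.coords i i' ∘ f) z u) (fderiv ℝ (P.coords i i' ∘ f) z v) = _
  rw [hderiv, hderiv, planeForm, areaForm_circle_smul, areaForm_circle_smul, areaForm_add_mul_I,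
    areaForm_add_mul_I, stdForm_apply, ← Finset.sum_add_sum_compl {i, i'},
    Finset.sum_pair (P.ne_of_det hdet),
    sum_areaForm_of_isTangent hdet hz (htangent u) (htangent v)]
  ring

end CornerPolyhedron

namespace CornerPolyhedron

/-! ### Maps of reduced spaces in terms of lifts to `ℂⁿ` -/

section Lifts

variable {m m' : ℕ} {P : CornerPolyhedron m} {Q : CornerPolyhedron m'}

/-- The vertex that defines the preferred chart at `p`. -/
def chartIndex (p : P.Model) : Fin (m + 1) := Classical.choose (P.exists_vertexSource p)

lemma mem_vertexSource_chartIndex (p : P.Model) : p ∈ P.vertexSource (chartIndex p) :=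
  Classical.choose_spec (P.exists_vertexSource p)

lemma extChartAt_mem_vertexTarget (p : P.Model) :
    extChartAt 𝓘(ℝ, ℂ × ℂ) p p ∈ P.vertexTarget (chartIndex p) :=
  (P.vertexChart _).map_source (mem_vertexSource_chartIndex p)

lemma eventually_mem_vertexTarget (p : P.Model) :
    ∀ᶠ z in 𝓝 (extChartAt 𝓘(ℝ, ℂ × ℂ) p p), z ∈ P.vertexTarget (chartIndex p) :=
  (P.isOpen_vertexTarget _).mem_nhds (extChartAt_mem_vertexTarget p)

/-- The section of `U_Δ → M_Δ` over the preferred chart at `p`, in the coordinates of that chart. -/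
def localSection (p : P.Model) : ℂ × ℂ → Fin (m + 2) → ℂ := P.vertexSection (chartIndex p)

lemma contDiffAt_localSection (p : P.Model) :
    ContDiffAt ℝ ∞ (localSection p) (extChartAt 𝓘(ℝ, ℂ × ℂ) p p) :=
  (P.contDiffOn_vertexSection _).contDiffAt (eventually_mem_vertexTarget p)

lemma differentiableAt_localSection (p : P.Model) :
    DifferentiableAt ℝ (localSection p) (extChartAt 𝓘(ℝ, ℂ × ℂ) p p) :=
  (contDiffAt_localSection p).differentiableAt (by simp)

lemma eventually_localSection_mem (p : P.Model) :
    ∀ᶠ z in 𝓝 (extChartAt 𝓘(ℝ, ℂ × ℂ) p p), localSection p z ∈ P.levelSet :=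
  (eventually_mem_vertexTarget p).mono fun _ hz => P.vertexSection_mem hz

/-- The point over `p` on the section over the preferred chart at `p`. -/
def representative (p : P.Model) : P.Level :=
  ⟨localSection p (extChartAt 𝓘(ℝ, ℂ × ℂ) p p), P.vertexSection_mem (extChartAt_mem_vertexTarget p)⟩

lemma quot_representative (p : P.Model) : P.quot (representative p) = p :=
  (P.vertexInv_of_mem (extChartAt_mem_vertexTarget p)).symm.trans
    ((P.vertexChart _).left_inv (mem_vertexSource_chartIndex p))

lemma modelForm_apply (p : P.Model) (u v : TangentSpace 𝓘(ℝ, ℂ × ℂ) p) :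
    P.modelForm p u v = planeForm u v := by
  have hid : (fun z => P.coords (chartIndex p).castSucc (chartIndex p).succ (localSection p z))
      =ᶠ[𝓝 (extChartAt 𝓘(ℝ, ℂ × ℂ) p p)] id :=
    (eventually_mem_vertexTarget p).mono fun _ hz => P.coords_vertexSection hz
  refine (planeForm_fderiv_coords_comp (P.delzant _) (differentiableAt_localSection p)
    (P.vertexSection_ne_zero (extChartAt_mem_vertexTarget p))
    (eventually_localSection_mem p) u v).symm.trans ?_
  rw [hid.fderiv_eq, fderiv_id]
  rfl

/-- Near the point `x` of `U_Δ`, the smooth map `G` is a lift of the map `F` of reduced spaces. -/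
structure IsLiftAt (F : P.Model → Q.Model) (G : (Fin (m + 2) → ℂ) → Fin (m' + 2) → ℂ)
    (x : Fin (m + 2) → ℂ) : Prop where
  contDiffAt : ContDiffAt ℝ ∞ G x
  eventually_quot : ∀ᶠ y in 𝓝 x, ∀ hy : y ∈ P.levelSet,
    ∃ h : G y ∈ Q.levelSet, F (P.quot ⟨y, hy⟩) = Q.quot ⟨G y, h⟩

namespace IsLiftAt

variable {F : P.Model → Q.Model} {G : (Fin (m + 2) → ℂ) → Fin (m' + 2) → ℂ} {p : P.Model}
  (hG : IsLiftAt F G (representative p).1)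

include hG

lemma contDiffAt_comp_localSection :
    ContDiffAt ℝ ∞ (G ∘ localSection p) (extChartAt 𝓘(ℝ, ℂ × ℂ) p p) :=
  ContDiffAt.comp (extChartAt 𝓘(ℝ, ℂ × ℂ) p p) hG.contDiffAt (contDiffAt_localSection p)

lemma eventually_extChartAt_symm : ∀ᶠ z in 𝓝 (extChartAt 𝓘(ℝ, ℂ × ℂ) p p),
    ∃ h : G (localSection p z) ∈ Q.levelSet,
      F ((extChartAt 𝓘(ℝ, ℂ × ℂ) p).symm z) = Q.quot ⟨G (localSection p z), h⟩ := by
  filter_upwards [eventually_mem_vertexTarget p,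
    (differentiableAt_localSection p).continuousAt.eventually hG.eventually_quot] with z hz hlift
  obtain ⟨h, hF⟩ := hlift (P.vertexSection_mem hz)
  exact ⟨h, (congrArg F (P.vertexInv_of_mem hz)).trans hF⟩

lemma mem_nonvanishing : G (representative p).1 ∈
    nonvanishing (chartIndex (F p)).castSucc (chartIndex (F p)).succ := by
  obtain ⟨h, hF⟩ := hG.eventually_quot.self_of_nhds (representative p).2
  refine (Q.quot_mem_vertexSource (x := ⟨_, h⟩)).1 ?_
  rw [← hF, show P.quot ⟨(representative p).1, _⟩ = p from quot_representative p]
  exact mem_vertexSource_chartIndex (F p)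

lemma writtenInExtChartAt_eq :
    writtenInExtChartAt 𝓘(ℝ, ℂ × ℂ) 𝓘(ℝ, ℂ × ℂ) p F =ᶠ[𝓝 (extChartAt 𝓘(ℝ, ℂ × ℂ) p p)]
      fun z => Q.coords (chartIndex (F p)).castSucc (chartIndex (F p)).succ
        (G (localSection p z)) := by
  filter_upwards [hG.eventually_extChartAt_symm] with z ⟨h, hF⟩
  exact congrArg (extChartAt 𝓘(ℝ, ℂ × ℂ) (F p)) hF

lemma continuousAt : ContinuousAt F p := by
  have hchart : ContinuousAt (extChartAt 𝓘(ℝ, ℂ × ℂ) p) p := continuousAt_extChartAt p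
  have hcoords := ((contDiffAt_coords (P := Q) hG.mem_nonvanishing).comp
    (extChartAt 𝓘(ℝ, ℂ × ℂ) p p) hG.contDiffAt_comp_localSection).continuousAt.comp hchart
  have heq : F =ᶠ[𝓝 p] fun q => Q.vertexInv (chartIndex (F p)) (Q.coords
      (chartIndex (F p)).castSucc (chartIndex (F p)).succ
        (G (localSection p (extChartAt 𝓘(ℝ, ℂ × ℂ) p q)))) := by
    filter_upwards [extChartAt_source_mem_nhds (I := 𝓘(ℝ, ℂ × ℂ)) p,
      hchart.eventually hG.eventually_extChartAt_symm,
      (hG.contDiffAt_comp_localSection.continuousAt.comp hchart).preimage_mem_nhds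
        ((isOpen_nonvanishing _ _).mem_nhds hG.mem_nonvanishing)] with q hq ⟨h, hF⟩ hsource
    rw [(extChartAt 𝓘(ℝ, ℂ × ℂ) p).left_inv hq] at hF
    exact hF.trans ((Q.vertexChart _).left_inv
      ((Q.quot_mem_vertexSource (x := ⟨_, h⟩)).2 hsource)).symm
  refine ContinuousAt.congr ?_ heq.symm
  obtain ⟨h, -⟩ := hG.eventually_quot.self_of_nhds (representative p).2
  exact ContinuousAt.comp (f := fun q => Q.coords (chartIndex (F p)).castSucc
    (chartIndex (F p)).succ (G (localSection p (extChartAt 𝓘(ℝ, ℂ × ℂ) p q))))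
    ((Q.vertexChart _).continuousAt_symm (Q.coords_mem (x := ⟨_, h⟩) hG.mem_nonvanishing)) hcoords

lemma contMDiffAt : ContMDiffAt 𝓘(ℝ, ℂ × ℂ) 𝓘(ℝ, ℂ × ℂ) ∞ F p := by
  refine contMDiffAt_iff.2 ⟨hG.continuousAt, ContDiffAt.contDiffWithinAt ?_⟩
  exact (ContDiffAt.comp (extChartAt 𝓘(ℝ, ℂ × ℂ) p p) (contDiffAt_coords hG.mem_nonvanishing)
    hG.contDiffAt_comp_localSection).congr_of_eventuallyEq hG.writtenInExtChartAt_eq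

lemma modelForm_mfderiv (u v : TangentSpace 𝓘(ℝ, ℂ × ℂ) p) :
    Q.modelForm (F p) (mfderiv 𝓘(ℝ, ℂ × ℂ) 𝓘(ℝ, ℂ × ℂ) F p u)
        (mfderiv 𝓘(ℝ, ℂ × ℂ) 𝓘(ℝ, ℂ × ℂ) F p v) =
      stdForm (m' + 2) (fderiv ℝ (G ∘ localSection p) (extChartAt 𝓘(ℝ, ℂ × ℂ) p p) u)
        (fderiv ℝ (G ∘ localSection p) (extChartAt 𝓘(ℝ, ℂ × ℂ) p p) v) := by
  rw [modelForm_apply, (hG.contMDiffAt.mdifferentiableAt (by simp)).mfderiv]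
  simp only [modelWithCornersSelf_coe, Set.range_id, fderivWithin_univ]
  rw [hG.writtenInExtChartAt_eq.fderiv_eq]
  exact planeForm_fderiv_coords_comp (Q.delzant _)
    (hG.contDiffAt_comp_localSection.differentiableAt (by simp)) hG.mem_nonvanishing
    (hG.eventually_extChartAt_symm.mono fun _ hz => hz.1) u v

lemma modelForm_mfderiv_eq_planeForm {i i' : Fin (m' + 2)} (hdet : det₂ (Q.v i) (Q.v i') = 1)
    (hi : G (representative p).1 ∈ nonvanishing i i') (u v : TangentSpace 𝓘(ℝ, ℂ × ℂ) p) :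
    Q.modelForm (F p) (mfderiv 𝓘(ℝ, ℂ × ℂ) 𝓘(ℝ, ℂ × ℂ) F p u)
        (mfderiv 𝓘(ℝ, ℂ × ℂ) 𝓘(ℝ, ℂ × ℂ) F p v) =
      planeForm
        (fderiv ℝ (fun z => Q.coords i i' (G (localSection p z))) (extChartAt 𝓘(ℝ, ℂ × ℂ) p p) u)
        (fderiv ℝ (fun z => Q.coords i i' (G (localSection p z))) (extChartAt 𝓘(ℝ, ℂ × ℂ) p p) v) :=
  (hG.modelForm_mfderiv u v).trans (planeForm_fderiv_coords_comp hdet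
    (hG.contDiffAt_comp_localSection.differentiableAt (by simp)) hi
    (hG.eventually_extChartAt_symm.mono fun _ hz => hz.1) u v).symm

end IsLiftAt

end Lifts

/-! ### Smoothness of the mirror map -/

variable {m : ℕ} {P Q : CornerPolyhedron m} {b b' : ℝ} {θ : ℝ → ℝ}

lemma stdForm_conjRev (u v : Fin (m + 2) → ℂ) :
    stdForm (m + 2) (conjRev u) (conjRev v) = -stdForm (m + 2) u v := by
  rw [stdForm_apply, stdForm_apply, ← Finset.sum_neg_distrib]
  exact Fintype.sum_equiv Fin.revPerm _ _ fun _ => areaForm_conj _ _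

lemma fderiv_conjRev_comp {E : Type*} [NormedAddCommGroup E] [NormedSpace ℝ E]
    {f : E → Fin (m + 2) → ℂ} {z : E} (hf : DifferentiableAt ℝ f z) (u : E) :
    fderiv ℝ (conjRev ∘ f) z u = conjRev (fderiv ℝ f z u) := by
  have hcomp : HasFDerivAt (conjRev ∘ f) (ContinuousLinearMap.pi fun j : Fin (m + 2) =>
      Complex.conjCLE.toContinuousLinearMap ∘L
        ContinuousLinearMap.proj j.rev ∘L fderiv ℝ f z) z :=
    hasFDerivAt_pi.2 fun j => Complex.conjCLE.hasFDerivAt.comp z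
      (hasFDerivAt_pi'.1 hf.hasFDerivAt j.rev)
  rw [hcomp.fderiv]
  rfl

namespace TwistProfile

variable (hθ : P.TwistProfile b b' θ) (hPQ : P.IsMirror Q)

lemma isLiftAt_conjRev {x : Fin (m + 2) → ℂ} (hx : diagMoment x < b') :
    IsLiftAt (hθ.mirrorMap hPQ) conjRev x where
  contDiffAt := contDiff_conjRev.contDiffAt
  eventually_quot := by
    filter_upwards [continuous_diagMoment.continuousAt.eventually_lt_const hx] with y hlt hy
    exact ⟨_, hθ.mirrorMap_quot_of_lt hPQ (x := ⟨y, hy⟩) hlt⟩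

lemma isLiftAt_blowupSection {x : P.Level} (hx : b < diagMoment x.1) :
    IsLiftAt (hθ.mirrorMap hPQ)
      (Q.blowupSection ∘ planeTwist θ ∘ P.coords 0 (Fin.last (m + 1))) x.1 where
  contDiffAt := ContDiffAt.comp (g := Q.blowupSection) x.1
    (contDiffAt_blowupSection (hθ.planeTwist_mem_blowupTarget hPQ hx))
    ((contDiff_planeTwist hθ.smooth).contDiffAt.comp x.1
      (contDiffAt_coords (hθ.mem_nonvanishing hx)))
  eventually_quot := by
    filter_upwards [continuous_diagMoment.continuousAt.eventually_const_lt hx] with y hlt hy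
    exact ⟨_, hθ.mirrorMap_quot_of_gt hPQ (x := ⟨y, hy⟩) hlt⟩

lemma contMDiff_mirrorMap : ContMDiff 𝓘(ℝ, ℂ × ℂ) 𝓘(ℝ, ℂ × ℂ) ∞ (hθ.mirrorMap hPQ) := fun p =>
  (lt_or_ge (diagMoment (representative p).1) b').elim
    (fun h => (hθ.isLiftAt_conjRev hPQ h).contMDiffAt)
    (fun h => (hθ.isLiftAt_blowupSection hPQ (hθ.lt.trans_le h)).contMDiffAt)

/-- The mirror diffeomorphism of reduced spaces. -/
def modelDiffeo : P.Model ≃ₘ⟮𝓘(ℝ, ℂ × ℂ), 𝓘(ℝ, ℂ × ℂ)⟯ Q.Model where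
  toFun := hθ.mirrorMap hPQ
  invFun := (hθ.neg hPQ).mirrorMap hPQ.symm
  left_inv := hθ.mirrorMap_mirrorMap hPQ
  right_inv q := by
    have h := (hθ.neg hPQ).mirrorMap_mirrorMap hPQ.symm q
    simp only [neg_neg] at h
    exact h
  contMDiff_toFun := hθ.contMDiff_mirrorMap hPQ
  contMDiff_invFun := (hθ.neg hPQ).contMDiff_mirrorMap hPQ.symm

lemma modelForm_mirrorMap_of_lt {p : P.Model} (h : diagMoment (representative p).1 < b')
    (u v : TangentSpace 𝓘(ℝ, ℂ × ℂ) p) :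
    Q.modelForm (hθ.mirrorMap hPQ p)
        (mfderiv 𝓘(ℝ, ℂ × ℂ) 𝓘(ℝ, ℂ × ℂ) (hθ.mirrorMap hPQ) p u)
        (mfderiv 𝓘(ℝ, ℂ × ℂ) 𝓘(ℝ, ℂ × ℂ) (hθ.mirrorMap hPQ) p v) = -P.modelForm p u v :=
  ((hθ.isLiftAt_conjRev hPQ h).modelForm_mfderiv u v).trans
    ((congrArg₂ (fun x y => stdForm (m + 2) x y)
      (fderiv_conjRev_comp (differentiableAt_localSection p) u)
      (fderiv_conjRev_comp (differentiableAt_localSection p) v)).trans (stdForm_conjRev _ _))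

lemma modelForm_mirrorMap_of_gt {p : P.Model} (h : b < diagMoment (representative p).1)
    (u v : TangentSpace 𝓘(ℝ, ℂ × ℂ) p) :
    Q.modelForm (hθ.mirrorMap hPQ p)
        (mfderiv 𝓘(ℝ, ℂ × ℂ) 𝓘(ℝ, ℂ × ℂ) (hθ.mirrorMap hPQ) p u)
        (mfderiv 𝓘(ℝ, ℂ × ℂ) 𝓘(ℝ, ℂ × ℂ) (hθ.mirrorMap hPQ) p v) =
      planeForm
        (fderiv ℝ (planeTwist θ) (P.coords 0 (Fin.last (m + 1)) (representative p).1)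
          (fderiv ℝ (P.coords 0 (Fin.last (m + 1)) ∘ localSection p)
            (extChartAt 𝓘(ℝ, ℂ × ℂ) p p) u))
        (fderiv ℝ (planeTwist θ) (P.coords 0 (Fin.last (m + 1)) (representative p).1)
          (fderiv ℝ (P.coords 0 (Fin.last (m + 1)) ∘ localSection p)
            (extChartAt 𝓘(ℝ, ℂ × ℂ) p p) v)) := by
  have hlift := hθ.isLiftAt_blowupSection hPQ h
  have htwist : (fun z => Q.coords 0 (Fin.last (m + 1))
      ((Q.blowupSection ∘ planeTwist θ ∘ P.coords 0 (Fin.last (m + 1))) (localSection p z)))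
        =ᶠ[𝓝 (extChartAt 𝓘(ℝ, ℂ × ℂ) p p)]
        planeTwist θ ∘ P.coords 0 (Fin.last (m + 1)) ∘ localSection p := by
    filter_upwards [eventually_localSection_mem p,
      (differentiableAt_localSection p).continuousAt.eventually
        (continuous_diagMoment.continuousAt.eventually_const_lt h)] with z hz hlt
    exact coords_blowupSection (hθ.planeTwist_mem_blowupTarget hPQ (x := ⟨_, hz⟩) hlt)
  have hcoords : DifferentiableAt ℝ (P.coords 0 (Fin.last (m + 1)) ∘ localSection p)
      (extChartAt 𝓘(ℝ, ℂ × ℂ) p p) :=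
    DifferentiableAt.comp (g := P.coords 0 (Fin.last (m + 1))) _
      ((contDiffAt_coords (hθ.mem_nonvanishing h)).differentiableAt (by simp))
      (differentiableAt_localSection p)
  have hmem : (Q.blowupSection ∘ planeTwist θ ∘ P.coords 0 (Fin.last (m + 1)))
      (representative p).1 ∈ nonvanishing 0 (Fin.last (m + 1)) :=
    blowupSection_mem_nonvanishing (hθ.planeTwist_mem_blowupTarget hPQ h)
  have hfderiv := htwist.fderiv_eq.trans (fderiv_comp _
    ((contDiff_planeTwist hθ.smooth).differentiable (by simp) _) hcoords)
  refine (hlift.modelForm_mfderiv_eq_planeForm Q.det₂_first_last hmem u v).trans ?_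
  exact congrArg (fun L : (ℂ × ℂ) →L[ℝ] ℂ × ℂ => planeForm (L u) (L v)) hfderiv

lemma liouville_mirrorMap (p : P.Model) (u₁ u₂ u₃ u₄ : TangentSpace 𝓘(ℝ, ℂ × ℂ) p) :
    Q.modelForm.liouville (hθ.mirrorMap hPQ p)
        (mfderiv 𝓘(ℝ, ℂ × ℂ) 𝓘(ℝ, ℂ × ℂ) (hθ.mirrorMap hPQ) p u₁)
        (mfderiv 𝓘(ℝ, ℂ × ℂ) 𝓘(ℝ, ℂ × ℂ) (hθ.mirrorMap hPQ) p u₂)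
        (mfderiv 𝓘(ℝ, ℂ × ℂ) 𝓘(ℝ, ℂ × ℂ) (hθ.mirrorMap hPQ) p u₃)
        (mfderiv 𝓘(ℝ, ℂ × ℂ) 𝓘(ℝ, ℂ × ℂ) (hθ.mirrorMap hPQ) p u₄) =
      P.modelForm.liouville p u₁ u₂ u₃ u₄ := by
  rcases lt_or_ge (diagMoment (representative p).1) b' with h | h
  · simp only [BilinField.liouville, hθ.modelForm_mirrorMap_of_lt hPQ h, neg_mul_neg]
  · have hb := hθ.lt.trans_le h
    have hcoords : ∀ u v : TangentSpace 𝓘(ℝ, ℂ × ℂ) p, planeForm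
        (fderiv ℝ (P.coords 0 (Fin.last (m + 1)) ∘ localSection p)
          (extChartAt 𝓘(ℝ, ℂ × ℂ) p p) u)
        (fderiv ℝ (P.coords 0 (Fin.last (m + 1)) ∘ localSection p)
          (extChartAt 𝓘(ℝ, ℂ × ℂ) p p) v) = P.modelForm p u v :=
      planeForm_fderiv_coords_comp P.det₂_first_last (differentiableAt_localSection p)
        (hθ.mem_nonvanishing hb) (eventually_localSection_mem p)
    simp only [BilinField.liouville, hθ.modelForm_mirrorMap_of_gt hPQ hb, ← hcoords]
    exact halfWedgeSq_fderiv_planeTwist hθ.smooth _ _ _ _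

end TwistProfile

end CornerPolyhedron

/-! ### Existence of angle functions -/

/-- A smooth angle function that is `π` up to `b` and `0` from `β` on. -/
def angleProfile (b β s : ℝ) : ℝ := Real.pi * (1 - Real.smoothTransition ((s - b) / (β - b)))

lemma contDiff_angleProfile (b β : ℝ) : ContDiff ℝ ∞ (angleProfile b β) :=
  contDiff_const.mul (contDiff_const.sub
    (Real.smoothTransition.contDiff.comp ((contDiff_id.sub contDiff_const).div_const _)))

lemma angleProfile_of_le {b β s : ℝ} (hb : b < β) (hs : s ≤ b) :
    angleProfile b β s = Real.pi := by
  rw [angleProfile, Real.smoothTransition.zero_of_nonpos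
    (div_nonpos_of_nonpos_of_nonneg (sub_nonpos.2 hs) (sub_nonneg.2 hb.le)), sub_zero, mul_one]

lemma angleProfile_of_ge {b β s : ℝ} (hb : b < β) (hs : β ≤ s) : angleProfile b β s = 0 := by
  rw [angleProfile, Real.smoothTransition.one_of_one_le
    ((one_le_div (sub_pos.2 hb)).2 (sub_le_sub_right hs b)), sub_self, mul_zero]

namespace CornerPolyhedron

variable {m : ℕ} {P Q : CornerPolyhedron m} {b b' β : ℝ} {θ : ℝ → ℝ}

/-- The union of the edges of `Δ` other than the first and the last, which is the moment image of
the chain of spheres. -/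
def middleEdges (P : CornerPolyhedron m) : Set (ℝ × ℝ) :=
  {w | w ∈ P.toSet ∧ ∃ j ∈ middle m, pairing w (P.v j) = P.a j}

lemma continuous_pairing (v : ℤ × ℤ) : Continuous fun w => pairing w v := by
  unfold pairing
  fun_prop

lemma isClosed_middleEdges (P : CornerPolyhedron m) : IsClosed P.middleEdges := by
  have hinter : P.middleEdges = (⋂ i, {w | P.a i ≤ pairing w (P.v i)}) ∩
      ⋃ j ∈ middle m, {w | pairing w (P.v j) = P.a j} := by
    ext w
    simp [middleEdges, toSet]
  rw [hinter]
  exact (isClosed_iInter fun i => isClosed_le continuous_const (continuous_pairing _)).inter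
    ((middle m).finite_toSet.isClosed_biUnion fun j _ =>
      isClosed_eq (continuous_pairing _) continuous_const)

lemma nonneg_of_mem_toSet {w : ℝ × ℝ} (hw : w ∈ P.toSet) : 0 ≤ w.1 ∧ 0 ≤ w.2 := by
  have hfst := hw 0
  have hsnd := hw (Fin.last (m + 1))
  simp only [P.v_first, P.a_first, P.v_last, P.a_last, pairing] at hfst hsnd
  exact ⟨by simpa using hfst, by simpa using hsnd⟩

lemma exists_lt_of_middleEdges_lt (h : ∀ w ∈ P.middleEdges, w.1 + w.2 < β) :
    ∃ b < β, ∀ w ∈ P.middleEdges, w.1 + w.2 ≤ b := by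
  rcases P.middleEdges.eq_empty_or_nonempty with hempty | hne
  · exact ⟨β - 1, sub_one_lt β, by simp [hempty]⟩
  have hcompact : IsCompact P.middleEdges := by
    refine (isCompact_Icc (a := ((0, 0) : ℝ × ℝ)) (b := (β, β))).of_isClosed_subset
      P.isClosed_middleEdges fun w hw => ?_
    obtain ⟨h1, h2⟩ := nonneg_of_mem_toSet hw.1
    have hlt := h w hw
    exact ⟨⟨h1, h2⟩, by simp only; linarith, by simp only; linarith⟩
  obtain ⟨w, hw, hmax⟩ := hcompact.exists_isMaxOn hne
    (f := fun w => w.1 + w.2) (continuous_fst.add continuous_snd).continuousOn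
  exact ⟨w.1 + w.2, h w hw, fun w' hw' => hmax hw'⟩

lemma v_add_pos {j : Fin (m + 2)} (hj : j ∈ middle m) : 0 < ((P.v j).1 + (P.v j).2 : ℝ) := by
  have hfirst := P.counterclockwise 0 j (Fin.pos_iff_ne_zero.2 (mem_middle.1 hj).1)
  have hlast := P.counterclockwise j _ (Fin.lt_last_iff_ne_last.2 (mem_middle.1 hj).2)
  simp only [det₂, P.v_first, P.v_last] at hfirst hlast
  exact_mod_cast (by linarith : 0 < (P.v j).1 + (P.v j).2)

/-- The last middle edge that the ray from `w` in the direction `(1, 1)` crosses belongs to `Δ`. -/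
lemma exists_add_mem_middleEdges {w : ℝ × ℝ} (h1 : 0 ≤ w.1) (h2 : 0 ≤ w.2) {j : Fin (m + 2)}
    (hj : j ∈ middle m) (hw : pairing w (P.v j) ≤ P.a j) :
    ∃ t, 0 ≤ t ∧ (w.1 + t, w.2 + t) ∈ P.middleEdges := by
  let crossing (i : Fin (m + 2)) : ℝ := (P.a i - pairing w (P.v i)) / ((P.v i).1 + (P.v i).2)
  obtain ⟨l, hl, hmax⟩ := (middle m).exists_max_image crossing ⟨j, hj⟩
  have hnonneg : 0 ≤ crossing l :=
    (div_nonneg (sub_nonneg.2 hw) (v_add_pos hj).le).trans (hmax j hj)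
  have hpairing : ∀ t i, pairing (w.1 + t, w.2 + t) (P.v i) =
      pairing w (P.v i) + t * ((P.v i).1 + (P.v i).2) := fun t i => by
    simp only [pairing]
    ring
  refine ⟨crossing l, hnonneg, fun i => ?_, l, hl, ?_⟩
  · by_cases h0 : i = 0
    · subst h0
      simpa [P.v_first, P.a_first, pairing] using add_nonneg h1 hnonneg
    by_cases hlast : i = Fin.last (m + 1)
    · subst hlast
      simpa [P.v_last, P.a_last, pairing] using add_nonneg h2 hnonneg
    have hi := mem_middle.2 ⟨h0, hlast⟩
    rw [hpairing, ← sub_le_iff_le_add']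
    exact (div_le_iff₀ (v_add_pos hi)).1 (hmax i hi)
  · rw [hpairing, div_mul_cancel₀ _ (v_add_pos hl).ne', add_sub_cancel]

lemma mem_blowupTarget_of_lt (hb : ∀ w ∈ P.middleEdges, w.1 + w.2 ≤ b) {z : ℂ × ℂ}
    (hz : b < halfNormSq z) : z ∈ P.blowupTarget := fun j hj => by
  by_contra! hle
  obtain ⟨t, ht, hmem⟩ := exists_add_mem_middleEdges (w := planeMoment z)
    (by unfold planeMoment; positivity) (by unfold planeMoment; positivity) hj hle
  have hbound := hb _ hmem
  rw [halfNormSq_eq_planeMoment] at hz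
  linarith

lemma exists_twistProfile (h : ∀ w ∈ P.middleEdges, w.1 + w.2 < β) :
    ∃ b b' θ, P.TwistProfile b b' θ ∧ b < β ∧ ∀ s, β ≤ s → θ s = 0 := by
  obtain ⟨b, hb, hbound⟩ := exists_lt_of_middleEdges_lt h
  obtain ⟨b', hbb', hb'⟩ := exists_between hb
  refine ⟨b, b', angleProfile b' β, ⟨hbb', contDiff_angleProfile b' β, fun s hs => ?_,
    fun z hz => mem_blowupTarget_of_lt hbound hz⟩, hb, fun s hs => angleProfile_of_ge hb' hs⟩
  exact Circle.ext (by simp [angleProfile_of_le hb' hs.le])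

/-! ### Transport to corner manifolds -/

section Transport

variable {N : Type*} [TopologicalSpace N] [ChartedSpace (ℂ × ℂ) N] [MulAction (Circle × Circle) N]
  {N' : Type*} [TopologicalSpace N'] [ChartedSpace (ℂ × ℂ) N'] [MulAction (Circle × Circle) N']
  {Ω : BilinField N} {Φ : N → ℝ × ℝ} {Ω' : BilinField N'} {Φ' : N' → ℝ × ℝ}

lemma Identification.liouville_eq (ι : P.Identification Ω Φ) (p : N)
    (u₁ u₂ u₃ u₄ : TangentSpace 𝓘(ℝ, ℂ × ℂ) p) :
    P.modelForm.liouville (ι.toDiffeo p)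
        (mfderiv 𝓘(ℝ, ℂ × ℂ) 𝓘(ℝ, ℂ × ℂ) ι.toDiffeo p u₁)
        (mfderiv 𝓘(ℝ, ℂ × ℂ) 𝓘(ℝ, ℂ × ℂ) ι.toDiffeo p u₂)
        (mfderiv 𝓘(ℝ, ℂ × ℂ) 𝓘(ℝ, ℂ × ℂ) ι.toDiffeo p u₃)
        (mfderiv 𝓘(ℝ, ℂ × ℂ) 𝓘(ℝ, ℂ × ℂ) ι.toDiffeo p u₄) = Ω.liouville p u₁ u₂ u₃ u₄ := by
  simp only [BilinField.liouville, ι.symplectic]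

namespace TwistProfile

lemma halfNormSq_modelBlowup (hθ : P.TwistProfile b b' θ) {p : P.Model}
    (hp : b < (P.modelMoment p).1 + (P.modelMoment p).2) :
    halfNormSq (P.modelBlowup p) = (P.modelMoment p).1 + (P.modelMoment p).2 := by
  obtain ⟨x, rfl⟩ := P.quot_surjective p
  rw [modelMoment_quot, ← halfNormSq_eq_planeMoment] at hp ⊢
  exact halfNormSq_coords (hθ.mem_nonvanishing hp)

variable (hθ : P.TwistProfile b b' θ) (hPQ : P.IsMirror Q) (ι : P.Identification Ω Φ)
  (ι' : Q.Identification Ω' Φ')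

/-- The diffeomorphism of corner manifolds that corresponds to `modelDiffeo`. -/
def mirrorDiffeo : N ≃ₘ⟮𝓘(ℝ, ℂ × ℂ), 𝓘(ℝ, ℂ × ℂ)⟯ N' :=
  (ι.toDiffeo.trans (hθ.modelDiffeo hPQ)).trans ι'.toDiffeo.symm

lemma toDiffeo_mirrorDiffeo (p : N) :
    ι'.toDiffeo (hθ.mirrorDiffeo hPQ ι ι' p) = hθ.mirrorMap hPQ (ι.toDiffeo p) :=
  ι'.toDiffeo.apply_symm_apply _

lemma moment_mirrorDiffeo (p : N) :
    Φ' (hθ.mirrorDiffeo hPQ ι ι' p) = Q.modelMoment (hθ.mirrorMap hPQ (ι.toDiffeo p)) := by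
  rw [← ι'.moment, toDiffeo_mirrorDiffeo]

lemma moment_mirrorDiffeo_add (p : N) :
    (Φ' (hθ.mirrorDiffeo hPQ ι ι' p)).1 + (Φ' (hθ.mirrorDiffeo hPQ ι ι' p)).2 =
      (Φ p).1 + (Φ p).2 := by
  rw [hθ.moment_mirrorDiffeo hPQ ι ι', hθ.modelMoment_mirrorMap, ι.moment]

lemma mfderiv_toDiffeo_mirrorDiffeo (p : N) (u : TangentSpace 𝓘(ℝ, ℂ × ℂ) p) :
    (mfderiv 𝓘(ℝ, ℂ × ℂ) 𝓘(ℝ, ℂ × ℂ) ι'.toDiffeo (hθ.mirrorDiffeo hPQ ι ι' p)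
        (mfderiv 𝓘(ℝ, ℂ × ℂ) 𝓘(ℝ, ℂ × ℂ) (hθ.mirrorDiffeo hPQ ι ι') p u) : ℂ × ℂ) =
      mfderiv 𝓘(ℝ, ℂ × ℂ) 𝓘(ℝ, ℂ × ℂ) (hθ.mirrorMap hPQ) (ι.toDiffeo p)
        (mfderiv 𝓘(ℝ, ℂ × ℂ) 𝓘(ℝ, ℂ × ℂ) ι.toDiffeo p u) := by
  set H := hθ.mirrorDiffeo hPQ ι ι'
  have hcomp : ι'.toDiffeo ∘ H = hθ.mirrorMap hPQ ∘ ι.toDiffeo :=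
    funext (hθ.toDiffeo_mirrorDiffeo hPQ ι ι')
  have hleft := mfderiv_comp (I := 𝓘(ℝ, ℂ × ℂ)) (I' := 𝓘(ℝ, ℂ × ℂ)) (I'' := 𝓘(ℝ, ℂ × ℂ)) p
    ((ι'.toDiffeo.contMDiff (H p)).mdifferentiableAt (by simp))
    ((H.contMDiff p).mdifferentiableAt (by simp))
  have hright := mfderiv_comp (I := 𝓘(ℝ, ℂ × ℂ)) (I' := 𝓘(ℝ, ℂ × ℂ)) (I'' := 𝓘(ℝ, ℂ × ℂ)) p
    ((hθ.contMDiff_mirrorMap hPQ (ι.toDiffeo p)).mdifferentiableAt (by simp))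
    ((ι.toDiffeo.contMDiff p).mdifferentiableAt (by simp))
  rw [hcomp, hright] at hleft
  exact (congrArg (fun L : (ℂ × ℂ) →L[ℝ] ℂ × ℂ => L u) hleft).symm

lemma preservesOrientation_mirrorDiffeo :
    PreservesOrientation Ω Ω' (hθ.mirrorDiffeo hPQ ι ι') := by
  intro p u₁ u₂ u₃ u₄ hpos
  rw [← ι.liouville_eq, ← hθ.liouville_mirrorMap hPQ] at hpos
  rw [← ι'.liouville_eq]
  simp only [BilinField.liouville, modelForm_apply] at hpos ⊢
  simp only [hθ.mfderiv_toDiffeo_mirrorDiffeo hPQ ι ι']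
  exact hpos

lemma blowup_mirrorDiffeo {p : N} (hb : b < (Φ p).1 + (Φ p).2)
    (hzero : θ ((Φ p).1 + (Φ p).2) = 0) :
    ι'.blowup (hθ.mirrorDiffeo hPQ ι ι' p) = ι.blowup p := by
  rw [← ι.moment] at hb hzero
  rw [Identification.blowup, hθ.toDiffeo_mirrorDiffeo, hθ.modelBlowup_mirrorMap hPQ hb]
  refine planeTwist_of_exp_eq_one ?_
  rw [hθ.halfNormSq_modelBlowup hb, hzero, Circle.exp_zero]

lemma mirrorDiffeo_mem_sphere_iff {i : Fin (m + 2)} (hi : i ∈ middle m) (p : N) :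
    hθ.mirrorDiffeo hPQ ι ι' p ∈ Q.sphere Φ' i.rev ↔ p ∈ P.sphere Φ i := by
  rw [sphere, sphere, Set.mem_ofPred_eq, Set.mem_ofPred_eq, hθ.moment_mirrorDiffeo hPQ ι ι',
    ← ι.moment]
  exact hθ.pairing_modelMoment_mirrorMap hPQ _ hi

lemma mirrorDiffeo_image_sphere {i : Fin (m + 2)} (hi : i ∈ middle m) :
    hθ.mirrorDiffeo hPQ ι ι' '' P.sphere Φ i = Q.sphere Φ' i.rev := by
  ext q
  obtain ⟨p, rfl⟩ := (hθ.mirrorDiffeo hPQ ι ι').surjective q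
  exact (hθ.mirrorDiffeo hPQ ι ι').injective.mem_set_image.trans
    (hθ.mirrorDiffeo_mem_sphere_iff hPQ ι ι' hi p).symm

lemma mirrorDiffeo_notMem_chain {p : N} (hp : p ∉ P.chain Φ) :
    hθ.mirrorDiffeo hPQ ι ι' p ∉ Q.chain Φ' := by
  simp only [chain, Set.mem_iUnion, not_exists] at hp ⊢
  intro i hi hmem
  have hi' := rev_mem_middle.2 (mem_middle.2 hi)
  rw [← i.rev_rev, hθ.mirrorDiffeo_mem_sphere_iff hPQ ι ι' hi'] at hmem
  exact hp _ (mem_middle.1 hi') hmem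

lemma mirrorDiffeo_antidiagonal (g : Circle) (p : N) :
    hθ.mirrorDiffeo hPQ ι ι' (((g, g⁻¹) : Circle × Circle) • p) =
      ((g, g⁻¹) : Circle × Circle) • hθ.mirrorDiffeo hPQ ι ι' p := by
  apply ι'.toDiffeo.injective
  simp only [Diffeomorph.coe_toEquiv]
  rw [ι'.equivariant, hθ.toDiffeo_mirrorDiffeo, hθ.toDiffeo_mirrorDiffeo, ι.equivariant,
    hθ.mirrorMap_antidiagonal]

end TwistProfile

end Transport

end CornerPolyhedron

end

theorem mainTheorem8 {m : ℕ} (P : CornerPolyhedron m)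
    {N : Type*} [TopologicalSpace N] [ChartedSpace (ℂ × ℂ) N] [MulAction (Circle × Circle) N]
    {N' : Type*} [TopologicalSpace N'] [ChartedSpace (ℂ × ℂ) N'] [MulAction (Circle × Circle) N']
    (Ω : BilinField N) (Φ : N → ℝ × ℝ) (Ω' : BilinField N') (Φ' : N' → ℝ × ℝ)
    (hN : IsCornerManifold Ω Φ) (hΔ : Set.range Φ = P.toSet)
    (hN' : IsCornerManifold Ω' Φ') (hΔ' : Set.range Φ' = P.mirror.toSet)
    (ι : P.Identification Ω Φ) (ι' : P.mirror.Identification Ω' Φ')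
    (β : ℝ) (hβ : 0 < β) (hU : P.chain Φ ⊆ triangular Φ β) :
    ∃ H : N ≃ₘ⟮𝓘(ℝ, ℂ × ℂ), 𝓘(ℝ, ℂ × ℂ)⟯ N',
      PreservesOrientation Ω Ω' H ∧
      (∀ p, p ∉ triangular Φ β →
        H p ∉ P.mirror.chain Φ' ∧ ι'.blowup (H p) = ι.blowup p) ∧
      (∀ p, (Φ' (H p)).1 + (Φ' (H p)).2 = (Φ p).1 + (Φ p).2) ∧
      (∀ (l : Circle) (p : N),
        H (((l, l⁻¹) : Circle × Circle) • p) = ((l, l⁻¹) : Circle × Circle) • H p) ∧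
      (∀ i : Fin (m + 2), i ≠ 0 → i ≠ Fin.last (m + 1) →
        H '' P.sphere Φ i = P.mirror.sphere Φ' i.rev) := by
  have hedges : ∀ w ∈ P.middleEdges, w.1 + w.2 < β := by
    rintro w ⟨hw, j, hj, hwj⟩
    rw [← hΔ] at hw
    obtain ⟨p, rfl⟩ := hw
    exact (hU (Set.mem_biUnion (x := j) (CornerPolyhedron.mem_middle.1 hj) hwj)).2.2
  obtain ⟨b, b', θ, hθ, hb, hzero⟩ := CornerPolyhedron.exists_twistProfile hedges
  have hPQ := P.isMirror_mirror
  refine ⟨hθ.mirrorDiffeo hPQ ι ι', hθ.preservesOrientation_mirrorDiffeo hPQ ι ι', fun p hp => ?_,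
    hθ.moment_mirrorDiffeo_add hPQ ι ι', hθ.mirrorDiffeo_antidiagonal hPQ ι ι',
    fun i h0 h1 => hθ.mirrorDiffeo_image_sphere hPQ ι ι'
      (CornerPolyhedron.mem_middle.2 ⟨h0, h1⟩)⟩
  have hge : β ≤ (Φ p).1 + (Φ p).2 := not_lt.1 fun hlt =>
    hp ⟨(hN.image_subset p).1, (hN.image_subset p).2, hlt⟩
  exact ⟨hθ.mirrorDiffeo_notMem_chain hPQ ι ι' fun hmem => hp (hU hmem),
    hθ.blowup_mirrorDiffeo hPQ ι ι' (hb.trans_le hge) (hzero _ hge)⟩
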